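/- A $C^\infty$-ring is a model of the algebraic theory whose $n$-ary operations are the smooth functions $\mathbb{R}^n\to\mathbb{R}$; it has an underlying commutative $\mathbb{R}$-algebra. A $C^\infty$-ring is Weil if its underlying $\mathbb{R}$-algebra is a Weil algebra, that is, finite dimensional with an augmentation to $\mathbb{R}$ whose kernel is nilpotent. A $C^\infty$-ring $A$ is $W$-determined (near-point determined) if the family of all morphisms of $C^\infty$-rings $A\to W$ with $W$ Weil is jointly monic. Let $\mathcal{C}_W$ be the opposite of the (essentially small) full category of those finitely generated $C^\infty$-rings $A$ which are $W$-determined, have exactly two idempotents (i.e. $\operatorname{Spec}A$ is connected) and admit a morphism $A\to\mathbb{R}$; write $\operatorname{Spec}A$ for the object of $\mathcal{C}_W$ given by $A$. Let $\widehat{\mathcal{C}_W}$ be the topos of presheaves of sets on $\mathcal{C}_W$. The algebras $C^\infty(\mathbb{R})$ and $\mathbb{R}[\epsilon]=\mathbb{R}[y]/(y^2)$ determine objects of $\mathcal{C}_W$. Regard as presheaves $T=\operatorname{Spec}\mathbb{R}[\epsilon]$, pointed by the map $0:1\to T$ given by $\epsilon\mapsto 0$, and $R=\operatorname{Spec}C^\infty(\mathbb{R})$,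 with the commutative ring structure induced by the smooth addition and multiplication of $\mathbb{R}$ (so that $R(\operatorname{Spec}A)\cong A$ as rings). The quotient $C^\infty(\mathbb{R})\to\mathbb{R}[\epsilon]$ sending the identity function to $\epsilon$ gives a map $T\to R$. The monoid of Euler reals determined by $T$ is the pullback of $0:1\to T$ along evaluation at $0$, $ev_0:T^T\to T$, with the multiplication given by the internal composition of $T^T$. A geometric morphism $p:\mathcal{E}\to\mathcal{S}$ is pre-cohesive if $p^*$ is fully faithful, the counit of $p^*\dashv p_*$ is monic, $p^*$ is cartesian closed (preserves exponentials) and $p_*$ preserves coequalizers. Then: (1) The canonical geometric morphism $p:\widehat{\mathcal{C}_W}\to\mathbf{Set}$ ($p^*$ the constant presheaf functor, $p_*$ the limit functor) is pre-cohesive. Moreover $p_*$ has a right adjoint, and the left adjoint $p_!$ of $p^*$ (the colimit functor) preserves finite products. (2) The monoid of Euler reals determined by $T$ in $\widehat{\mathcal{C}_W}$ is bi-directional: if $U$ denotes its subobject of invertible elements, then $p_!U\cong 1+1$. (3) This monoid coincides with the multiplicative part of $R$: there is an isomorphism of monoids $\varphi$ from the object of Euler reals to $(R,\cdot)$ such that,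 for generalized elements $r$ of the Euler reals and $t$ of $T$, the image of $r(t)$ in $R$ is the product of $\varphi(r)$ and the image of $t$. (4) $R$ is connected, that is, $p_!R\cong 1$. (5) $R$ satisfies the Kock-Lawvere (KL) axiom: if $D\to R$ is the subobject of elements of square zero, the map $R\times R\to R^D$, $(a,b)\mapsto(d\mapsto a+bd)$, is an isomorphism. -/

import Mathlib

open CategoryTheory Limits MonoidalCategory CartesianMonoidalCategory
open scoped ContDiff

noncomputable section

namespace RSDG

universe u v

/-! ### `C^∞`-rings -/

/-- The `n`-ary operations of the theory of `C^∞`-rings: smooth functions `ℝⁿ → ℝ`. -/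
def SmoothFn (n : ℕ) : Type := {f : (Fin n → ℝ) → ℝ // ContDiff ℝ ∞ f}

namespace SmoothFn

instance (n : ℕ) : CoeFun (SmoothFn n) (fun _ => (Fin n → ℝ) → ℝ) := ⟨Subtype.val⟩

/-- The `i`-th coordinate. -/
def proj {n : ℕ} (i : Fin n) : SmoothFn n := ⟨fun x => x i, by fun_prop⟩

/-- Constant functions. -/
def const {n : ℕ} (r : ℝ) : SmoothFn n := ⟨fun _ => r, by fun_prop⟩

/-- Addition `ℝ² → ℝ`. -/
def add : SmoothFn 2 := ⟨fun x => x 0 + x 1, by fun_prop⟩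

/-- Multiplication `ℝ² → ℝ`. -/
def mul : SmoothFn 2 := ⟨fun x => x 0 * x 1, by fun_prop⟩

/-- The composite `x ↦ f (g₁ x, …, gₘ x)`. -/
def comp {m n : ℕ} (f : SmoothFn m) (g : Fin m → SmoothFn n) : SmoothFn n :=
  ⟨fun x => f fun i => g i x, f.2.comp (contDiff_pi.2 fun i => (g i).2)⟩

end SmoothFn

/-- A `C^∞`-ring: a product preserving interpretation of all smooth functions `ℝⁿ → ℝ` as
`n`-ary operations on `A`. The ring and `ℝ`-algebra structure of `A` is the one which
these operations induce (`op_add`, `op_mul`, `op_const`). -/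
class CInftyRing (A : Type u) [CommRing A] [Algebra ℝ A] where
  op : {n : ℕ} → SmoothFn n → (Fin n → A) → A
  op_proj : ∀ {n : ℕ} (i : Fin n) (a : Fin n → A), op (SmoothFn.proj i) a = a i
  op_comp : ∀ {m n : ℕ} (f : SmoothFn m) (g : Fin m → SmoothFn n) (a : Fin n → A),
    op (f.comp g) a = op f fun i => op (g i) a
  op_add : ∀ a : Fin 2 → A, op SmoothFn.add a = a 0 + a 1
  op_mul : ∀ a : Fin 2 → A, op SmoothFn.mul a = a 0 * a 1
  op_const : ∀ (r : ℝ) (a : Fin 0 → A), op (SmoothFn.const r) a = algebraMap ℝ A r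


open CInftyRing

theorem op_const' {A : Type u} [CommRing A] [Algebra ℝ A] [CInftyRing A] {n : ℕ} (r : ℝ)
    (a : Fin n → A) : op (SmoothFn.const r) a = algebraMap ℝ A r := by
  rw [← op_const r (Fin.elim0 : Fin 0 → A)]
  have h := op_comp (SmoothFn.const r : SmoothFn 0) (fun i => Fin.elim0 i) a
  rw [show (fun i : Fin 0 => op (Fin.elim0 i : SmoothFn n) a) = Fin.elim0 from
    funext fun i => Fin.elim0 i] at h
  exact h

/-- A morphism of `C^∞`-rings: a map commuting with all operations (hence a homomorphism of
`ℝ`-algebras). -/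
@[ext]
structure CInftyHom (A B : Type*) [CommRing A] [Algebra ℝ A] [CInftyRing A]
    [CommRing B] [Algebra ℝ B] [CInftyRing B] where
  toFun : A → B
  map_op' : ∀ {n : ℕ} (f : SmoothFn n) (a : Fin n → A),
    toFun (op f a) = op f fun i => toFun (a i)

namespace CInftyHom

variable {A B C : Type*} [CommRing A] [Algebra ℝ A] [CInftyRing A]
  [CommRing B] [Algebra ℝ B] [CInftyRing B] [CommRing C] [Algebra ℝ C] [CInftyRing C]

instance : FunLike (CInftyHom A B) A B where
  coe := toFun
  coe_injective _ _ := CInftyHom.ext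

theorem map_op (φ : CInftyHom A B) {n : ℕ} (f : SmoothFn n) (a : Fin n → A) :
    φ (op f a) = op f fun i => φ (a i) := φ.map_op' f a

/-- The underlying homomorphism of `ℝ`-algebras. -/
def toAlgHom (φ : CInftyHom A B) : A →ₐ[ℝ] B :=
  have hc (r : ℝ) : φ (algebraMap ℝ A r) = algebraMap ℝ B r := by
    rw [← op_const r Fin.elim0, map_op, op_const]
  have hm (x y : A) : φ (x * y) = φ x * φ y := by
    have := φ.map_op SmoothFn.mul ![x, y]
    simpa [CInftyRing.op_mul] using this
  have ha (x y : A) : φ (x + y) = φ x + φ y := by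
    have := φ.map_op SmoothFn.add ![x, y]
    simpa [CInftyRing.op_add] using this
  { toFun := φ
    map_one' := by simpa using hc 1
    map_zero' := by simpa using hc 0
    map_mul' := hm
    map_add' := ha
    commutes' := hc }

@[simp] theorem toAlgHom_apply (φ : CInftyHom A B) (x : A) : φ.toAlgHom x = φ x := rfl

/-- The identity morphism. -/
protected def id : CInftyHom A A := ⟨id, fun _ _ => rfl⟩

/-- Composition of morphisms. -/
protected def comp (ψ : CInftyHom B C) (φ : CInftyHom A B) : CInftyHom A C :=
  ⟨fun x => ψ (φ x), fun f a => by rw [φ.map_op, ψ.map_op]⟩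

end CInftyHom

/-- The category of (small) `C^∞`-rings. -/
structure CInftyRingCat where
  carrier : Type
  [commRing : CommRing carrier]
  [algebra : Algebra ℝ carrier]
  [cinftyRing : CInftyRing carrier]

namespace CInftyRingCat

instance : CoeSort CInftyRingCat Type := ⟨carrier⟩

attribute [instance] commRing algebra cinftyRing

/-- Morphisms of bundled `C^∞`-rings. -/
@[ext]
structure Hom (A B : CInftyRingCat) where
  hom : CInftyHom A B

instance : Category CInftyRingCat where
  Hom A B := Hom A B
  id A := ⟨CInftyHom.id⟩
  comp f g := ⟨g.hom.comp f.hom⟩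

/-- An object `A` is (the ring underlying) a Weil algebra: it is finite dimensional over `ℝ`, and
has an augmentation `A → ℝ` with nilpotent kernel. -/
def IsWeil (A : CInftyRingCat) : Prop :=
  Module.Finite ℝ A ∧ ∃ φ : A →ₐ[ℝ] ℝ, ∀ a : A, φ a = 0 → IsNilpotent a

/-- Finitely generated: some finite family generates `A` under the operations. -/
def IsFinitelyGenerated : ObjectProperty CInftyRingCat := fun A =>
  ∃ (n : ℕ) (g : Fin n → A), ∀ a : A, ∃ f : SmoothFn n, op f g = a

/-- `A` has exactly two idempotents. Complemented subobjects of the affine scheme `Spec A`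
correspond to idempotents of `A`, so this says that `Spec A` is connected. -/
def IsConnected (A : CInftyRingCat) : Prop :=
  Nontrivial A ∧ ∀ e : A, IsIdempotentElem e → e = 0 ∨ e = 1

/-- `W`-determined (near-point determined): the morphisms from `A` with Weil codomain
are jointly monic (that is, jointly injective). -/
def IsWDetermined (A : CInftyRingCat) : Prop :=
  ∀ a b : A, (∀ W : CInftyRingCat, W.IsWeil → ∀ f : A ⟶ W, f.hom a = f.hom b) → a = b

end CInftyRingCat

/-! ### The objects `ℝ`, `ℝ[ε]` and `C^∞(ℝ)` -/

instance : CInftyRing ℝ where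
  op f a := f a
  op_proj _ _ := rfl
  op_comp _ _ _ := rfl
  op_add _ := rfl
  op_mul _ := rfl
  op_const _ _ := rfl

theorem SmoothFn.hasFDerivAt {n : ℕ} (f : SmoothFn n) (x : Fin n → ℝ) :
    HasFDerivAt f (fderiv ℝ f x) x :=
  (f.2.differentiable (by simp)).differentiableAt.hasFDerivAt

/-- The `C^∞`-ring structure of the dual numbers:
`f (x + v ε) = f x + (df)_x(v) ε`. -/
instance : CInftyRing (DualNumber ℝ) where
  op f a := TrivSqZeroExt.inl (f fun i => (a i).fst) +
    TrivSqZeroExt.inr (fderiv ℝ f (fun i => (a i).fst) fun i => (a i).snd)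
  op_proj {n} i a := by
    have h : HasFDerivAt (SmoothFn.proj i : SmoothFn n)
        (ContinuousLinearMap.proj (R := ℝ) (φ := fun _ : Fin n => ℝ) i) fun i => (a i).fst :=
      (ContinuousLinearMap.proj (R := ℝ) (φ := fun _ : Fin n => ℝ) i).hasFDerivAt
    rw [h.fderiv]
    ext <;> simp [SmoothFn.proj]
  op_comp {m n} f g a := by
    have h : HasFDerivAt (f.comp g)
        ((fderiv ℝ f fun i => g i fun i => (a i).fst).comp
          (ContinuousLinearMap.pi fun i => fderiv ℝ (g i) fun i => (a i).fst))
        fun i => (a i).fst :=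
      (f.hasFDerivAt _).comp _ (hasFDerivAt_pi.2 fun i => (g i).hasFDerivAt _)
    rw [h.fderiv]
    ext <;> simp [SmoothFn.comp]
  op_add a := by
    have h : HasFDerivAt SmoothFn.add
        (ContinuousLinearMap.proj (R := ℝ) (φ := fun _ : Fin 2 => ℝ) 0 +
          ContinuousLinearMap.proj (R := ℝ) (φ := fun _ : Fin 2 => ℝ) 1) fun i => (a i).fst :=
      (hasFDerivAt_apply 0 _).add (hasFDerivAt_apply 1 _)
    rw [h.fderiv]
    ext <;> simp [SmoothFn.add]
  op_mul a := by
    have h := (hasFDerivAt_apply (𝕜 := ℝ) (F' := fun _ : Fin 2 => ℝ) 0 fun i => (a i).fst).mul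
      (hasFDerivAt_apply (𝕜 := ℝ) (F' := fun _ : Fin 2 => ℝ) 1 fun i => (a i).fst)
    have h' : HasFDerivAt SmoothFn.mul _ fun i => (a i).fst := h
    rw [h'.fderiv]
    ext <;> simp [SmoothFn.mul]; ring
  op_const r a := by
    have h : HasFDerivAt (SmoothFn.const r : SmoothFn 0) 0 fun i => (a i).fst :=
      hasFDerivAt_const (𝕜 := ℝ) (F := ℝ) r (fun i : Fin 0 => (a i).fst)
    rw [h.fderiv]
    ext <;> simp [SmoothFn.const, TrivSqZeroExt.algebraMap_eq_inl]

/-- The algebra `C^∞(ℝ)` of smooth functions `ℝ → ℝ`. -/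
def smoothLine : Subalgebra ℝ (ℝ → ℝ) where
  carrier := {f : ℝ → ℝ | ContDiff ℝ ∞ f}
  mul_mem' {f g} (hf : ContDiff ℝ ∞ f) (hg : ContDiff ℝ ∞ g) := hf.mul hg
  add_mem' {f g} (hf : ContDiff ℝ ∞ f) (hg : ContDiff ℝ ∞ g) := hf.add hg
  algebraMap_mem' r := (contDiff_const : ContDiff ℝ ∞ fun _ : ℝ => r)

instance : CInftyRing smoothLine where
  op f a := ⟨fun t => f fun i => (a i).1 t,
    f.2.comp (contDiff_pi.2 fun i => show ContDiff ℝ ∞ (a i).1 from (a i).2)⟩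
  op_proj _ _ := rfl
  op_comp _ _ _ := rfl
  op_add _ := rfl
  op_mul _ := rfl
  op_const _ _ := rfl

/-- The identity function, which freely generates `C^∞(ℝ)`. -/
def smoothLine.X : smoothLine := ⟨id, (contDiff_id : ContDiff ℝ ∞ (id : ℝ → ℝ))⟩

/-- A smooth function of one variable as a unary operation. -/
def smoothLine.toSmoothFn (g : smoothLine) : SmoothFn 1 :=
  ⟨fun x => g.1 (x 0), (show ContDiff ℝ ∞ g.1 from g.2).comp (contDiff_apply ℝ ℝ 0)⟩

section Free

variable (A : Type u) [CommRing A] [Algebra ℝ A] [CInftyRing A]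

/-- `C^∞(ℝ)` is the free `C^∞`-ring on one generator. -/
def smoothLine.homEquiv : CInftyHom smoothLine A ≃ A where
  toFun φ := φ smoothLine.X
  invFun a := ⟨fun g => op (smoothLine.toSmoothFn g) fun _ => a, fun f g => by
    rw [← CInftyRing.op_comp]; rfl⟩
  left_inv φ := by
    ext g
    change op (smoothLine.toSmoothFn g) (fun _ => φ smoothLine.X) = φ g
    rw [← φ.map_op]; rfl
  right_inv a := op_proj (0 : Fin 1) fun _ => a

/-- The unique morphism of `C^∞`-rings `ℝ → A`. -/
def constHom : CInftyHom ℝ A where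
  toFun := algebraMap ℝ A
  map_op' {n} f a := by
    rw [← op_const' (n := 0) _ Fin.elim0]
    have h := CInftyRing.op_comp f (fun i => (SmoothFn.const (a i) : SmoothFn 0)) (Fin.elim0 : Fin 0 → A)
    simp only [op_const'] at h
    exact h

end Free

/-- The morphism `ℝ[ε] → ℝ` with `ε ↦ 0`. -/
def dualFst : CInftyHom (DualNumber ℝ) ℝ where
  toFun := TrivSqZeroExt.fst
  map_op' f a := by simp [op]

/-- Evaluation of smooth functions at a point. -/
def evalHom (t : ℝ) : CInftyHom smoothLine ℝ := ⟨fun g => g.1 t, fun _ _ => rfl⟩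

/-! ### The site -/

namespace CInftyRingCat

/-- The property defining the objects of the site: finitely generated, connected,
with a copoint, and `W`-determined. -/
def IsSiteAlgebra : ObjectProperty CInftyRingCat := fun A =>
  A.IsFinitelyGenerated ∧ A.IsConnected ∧ Nonempty (CInftyHom A ℝ) ∧ A.IsWDetermined

theorem isWeil_real : IsWeil ⟨ℝ⟩ :=
  ⟨inferInstanceAs (Module.Finite ℝ ℝ), AlgHom.id ℝ ℝ, fun a (ha : a = 0) => ha ▸ IsNilpotent.zero⟩

theorem isWeil_dual : IsWeil ⟨DualNumber ℝ⟩ :=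
  ⟨inferInstanceAs (Module.Finite ℝ (ℝ × ℝ)), dualFst.toAlgHom, fun a ha => ⟨2, by
    have h : TrivSqZeroExt.fst a = 0 := ha
    ext <;> simp [pow_two, h]⟩⟩

theorem isSiteAlgebra_dual : IsSiteAlgebra ⟨DualNumber ℝ⟩ := by
  refine ⟨⟨1, fun _ => DualNumber.eps, fun a => ?_⟩, ⟨inferInstanceAs (Nontrivial (DualNumber ℝ)),
    fun e he => ?_⟩, ⟨dualFst⟩, fun a b h => h ⟨DualNumber ℝ⟩ isWeil_dual (𝟙 _)⟩
  · refine ⟨⟨fun x => TrivSqZeroExt.fst a + TrivSqZeroExt.snd a * x 0, by fun_prop⟩, ?_⟩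
    have h : HasFDerivAt (fun x : Fin 1 → ℝ => a.fst + a.snd * x 0)
        (a.snd • ContinuousLinearMap.proj (R := ℝ) (φ := fun _ : Fin 1 => ℝ) 0)
        fun _ => (DualNumber.eps : DualNumber ℝ).fst :=
      ((hasFDerivAt_apply 0 _).const_mul a.snd).const_add a.fst
    ext
    · simp [CInftyRing.op]
    · change 0 + fderiv ℝ (fun x : Fin 1 → ℝ => a.fst + a.snd * x 0)
        (fun _ => (DualNumber.eps : DualNumber ℝ).fst) (fun _ => DualNumber.eps.snd) = a.snd
      rw [h.fderiv]
      simp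
  · have h1 := congrArg TrivSqZeroExt.fst he.eq
    have h2 := congrArg TrivSqZeroExt.snd he.eq
    simp only [TrivSqZeroExt.fst_mul, TrivSqZeroExt.snd_mul, smul_eq_mul,
      MulOpposite.smul_eq_mul_unop, MulOpposite.unop_op] at h1 h2
    have h3 : e.fst = 0 ∨ e.fst = 1 := by
      rcases eq_or_ne e.fst 0 with h0 | h0
      · exact Or.inl h0
      · exact Or.inr (mul_left_cancel₀ h0 (by rw [h1, mul_one]))
    rcases h3 with h | h
    · left; ext <;> simp_all
    · right; ext <;> simp_all
      
theorem isSiteAlgebra_smoothLine : IsSiteAlgebra ⟨smoothLine⟩ := by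
  refine ⟨⟨1, fun _ => smoothLine.X, fun g => ⟨smoothLine.toSmoothFn g, rfl⟩⟩,
    ⟨inferInstanceAs (Nontrivial smoothLine), fun e he => ?_⟩, ⟨evalHom 0⟩, fun a b h => ?_⟩
  · have hc : Continuous e.1 := (show ContDiff ℝ ∞ e.1 from e.2).continuous
    have h01 (t : ℝ) : e.1 t = 0 ∨ e.1 t = 1 := by
      have h : e.1 t * e.1 t = e.1 t := congrFun (congrArg Subtype.val he.eq) t
      rcases eq_or_ne (e.1 t) 0 with h0 | h0
      · exact Or.inl h0
      · exact Or.inr (mul_left_cancel₀ h0 (by rw [h, mul_one]))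
    have hconst (t : ℝ) : e.1 t = e.1 0 := by
      by_contra hne
      have hpre := (isPreconnected_univ (α := ℝ)).image e.1 hc.continuousOn
      have hhalf : (1 / 2 : ℝ) ∈ e.1 '' Set.univ := by
        rcases h01 t with h | h <;> rcases h01 0 with h' | h'
        · exact absurd (h.trans h'.symm) hne
        · exact hpre.ordConnected.out ⟨t, trivial, h⟩ ⟨0, trivial, h'⟩ ⟨by norm_num, by norm_num⟩
        · exact hpre.ordConnected.out ⟨0, trivial, h'⟩ ⟨t, trivial, h⟩ ⟨by norm_num, by norm_num⟩
        · exact absurd (h.trans h'.symm) hne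
      obtain ⟨s, -, hs⟩ := hhalf
      rcases h01 s with h | h <;> rw [h] at hs <;> norm_num at hs
    rcases h01 0 with h | h
    · exact Or.inl (Subtype.ext (funext fun t => (hconst t).trans h))
    · exact Or.inr (Subtype.ext (funext fun t => (hconst t).trans h))
  · exact Subtype.ext (funext fun t => h ⟨ℝ⟩ isWeil_real ⟨evalHom t⟩)

end CInftyRingCat

namespace CInftyRingCat

/-- Transport of a `C^∞`-ring along a bijection. -/
def transport (A : CInftyRingCat) {X : Type} (e : X ≃ A) : CInftyRingCat :=
  letI := e.commRing
  letI := e.algebra ℝ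
  letI : CInftyRing X :=
    { op := fun f a => e.symm (op f fun i => e (a i))
      op_proj := fun i a => by simp [CInftyRing.op_proj]
      op_comp := fun f g a => by simp [CInftyRing.op_comp]
      op_add := fun a => by simp [CInftyRing.op_add, Equiv.add_def]
      op_mul := fun a => by simp [CInftyRing.op_mul, Equiv.mul_def]
      op_const := fun r a => by
        rw [CInftyRing.op_const]; rfl }
  ⟨X⟩

/-- Transport along a bijection gives an isomorphic `C^∞`-ring. -/
def transportIso (A : CInftyRingCat) {X : Type} (e : X ≃ A) : A.transport e ≅ A where
  hom := ⟨e, fun f a => e.apply_symm_apply _⟩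
  inv := ⟨e.symm, fun f a => by
    change _ = e.symm (op f fun i => e (e.symm (a i)))
    simp⟩
  hom_inv_id := by
    apply Hom.ext; apply CInftyHom.ext; exact funext e.symm_apply_apply
  inv_hom_id := by
    apply Hom.ext; apply CInftyHom.ext; exact funext e.apply_symm_apply

/-- A finitely generated `C^∞`-ring is a quotient of the set of smooth functions on some `ℝⁿ`,
so the category of finitely generated `C^∞`-rings is essentially small. -/
instance : EssentiallySmall.{0} IsFinitelyGenerated.FullSubcategory := by
  rw [essentiallySmall_iff]
  refine ⟨?_, inferInstance⟩
  let I : Type := Σ (n : ℕ) (s : Setoid (SmoothFn n)) (_ : CommRing (Quotient s))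
    (_ : Algebra ℝ (Quotient s)), CInftyRing (Quotient s)
  let F : I → CInftyRingCat := fun p =>
    letI := p.2.2.1; letI := p.2.2.2.1; letI := p.2.2.2.2; ⟨Quotient p.2.1⟩
  let G : {p : I // IsFinitelyGenerated (F p)} → Skeleton IsFinitelyGenerated.FullSubcategory :=
    fun p => toSkeleton ⟨F p.1, p.2⟩
  refine small_of_surjective (f := G) fun Y => ?_
  obtain ⟨⟨A, n, g, hg⟩, rfl⟩ : ∃ Z, toSkeleton Z = Y := ⟨_, toSkeleton_fromSkeleton_obj Y⟩
  let e : Quotient (Setoid.ker fun f : SmoothFn n => op f g) ≃ A :=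
    Setoid.quotientKerEquivOfSurjective _ hg
  have hfg : IsFinitelyGenerated (A.transport e) := by
    refine ⟨n, fun i => e.symm (g i), fun a => ?_⟩
    obtain ⟨f, hf⟩ := hg (e a)
    refine ⟨f, ?_⟩
    change e.symm (op f fun i => e (e.symm (g i))) = a
    simpa using (congrArg e.symm hf).trans (e.symm_apply_apply a)
  refine ⟨⟨⟨n, _, (A.transport e).commRing, (A.transport e).algebra,
    (A.transport e).cinftyRing⟩, hfg⟩, ?_⟩
  rw [toSkeleton_eq_toSkeleton_iff]
  exact ⟨ObjectProperty.isoMk _ (A.transportIso e)⟩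

instance : EssentiallySmall.{0} IsSiteAlgebra.FullSubcategory :=
  essentiallySmall_of_fully_faithful
    (ObjectProperty.ιOfLE (show IsSiteAlgebra ≤ IsFinitelyGenerated from fun _ h => h.1))

end CInftyRingCat

/-- The site: the opposite of the category of finitely generated connected
`W`-determined `C^∞`-rings with a copoint. -/
abbrev Site : Type 1 := (CInftyRingCat.IsSiteAlgebra.FullSubcategory)ᵒᵖ

/-- The topos of presheaves of sets on the (essentially small) site. -/
abbrev Psh : Type 1 := Siteᵒᵖ ⥤ Type

instance : HasColimitsOfShape Siteᵒᵖ Type := hasColimitsOfShape_of_essentiallySmall.{0} _ _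
instance : HasLimitsOfShape Siteᵒᵖ Type := hasLimitsOfShape_of_essentiallySmall.{0} _ _

/-! ### Radically synthetic notions in a cartesian closed category -/

section Generic

open MonObj

variable {E : Type u} [Category.{v} E] [CartesianMonoidalCategory E]

section EulerReals

variable (T : E) (o : 𝟙_ E ⟶ T) [Closed T]

/-- Evaluation at the point `o` of `T`, the tangent bundle map `X^T ⟶ X`. -/
def evalAt (X : E) : (ihom T).obj X ⟶ X :=
  (λ_ _).inv ≫ (o ▷ _) ≫ (ihom.ev T).app X

/-- The internal composition `(g, f) ↦ g ∘ f` of `T^T`. -/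
def endComp : (ihom T).obj T ⊗ (ihom T).obj T ⟶ (ihom T).obj T :=
  lift (snd _ _) (fst _ _) ≫ MonoidalClosed.comp T T T

/-- The value `f(t)` of a generalized element `f` of `X^T` at a generalized element `t` of `T`. -/
def applyAt {T : E} [Closed T] {X Z : E} (f : Z ⟶ (ihom T).obj X) (t : Z ⟶ T) : Z ⟶ X :=
  lift t f ≫ (ihom.ev T).app X

theorem comp_applyAt {X Z Y : E} (y : Y ⟶ Z) (f : Z ⟶ (ihom T).obj X) (t : Z ⟶ T) :
    y ≫ applyAt f t = applyAt (y ≫ f) (y ≫ t) := by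
  simp [applyAt, comp_lift_assoc]

theorem applyAt_endComp {Z : E} (g f : Z ⟶ (ihom T).obj T) (t : Z ⟶ T) :
    applyAt (lift g f ≫ endComp T) t = applyAt g (applyAt f t) := by
  have h : lift t (lift g f ≫ endComp T) = lift t (lift f g) ≫ T ◁ MonoidalClosed.comp T T T := by
    simp [endComp, comp_lift_assoc]
  have h2 : lift t (lift f g) ≫ (α_ T ((ihom T).obj T) ((ihom T).obj T)).inv =
      lift (lift t f) g := by simp
  rw [applyAt, h, Category.assoc, MonoidalClosed.comp, ← MonoidalClosed.uncurry_eq,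
    MonoidalClosed.uncurry_curry, MonoidalClosed.compTranspose_eq, reassoc_of% h2]
  simp [applyAt]

theorem applyAt_id {Z : E} (z : Z ⟶ 𝟙_ E) (t : Z ⟶ T) :
    applyAt (z ≫ MonoidalClosed.id T) t = t := by
  have h : lift t (z ≫ MonoidalClosed.id T) = lift t z ≫ T ◁ MonoidalClosed.id T := by simp
  rw [applyAt, h, Category.assoc, MonoidalClosed.id_eq, ← MonoidalClosed.uncurry_eq,
    MonoidalClosed.uncurry_curry]
  simp

theorem comp_evalAt {Z X : E} (f : Z ⟶ (ihom T).obj X) :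
    f ≫ evalAt T o X = applyAt f (toUnit Z ≫ o) := by
  have h : f ≫ (λ_ _).inv ≫ (o ▷ (ihom T).obj X) = lift (toUnit Z ≫ o) f := by
    ext <;> simp
  simp only [evalAt, applyAt, ← h, Category.assoc]

variable {T} in
theorem ihom_ext {Z X : E} {f g : Z ⟶ (ihom T).obj X}
    (h : ∀ {Y : E} (y : Y ⟶ Z) (t : Y ⟶ T), applyAt (y ≫ f) t = applyAt (y ≫ g) t) : f = g := by
  apply MonoidalClosed.uncurry_injective
  have := h (snd T Z) (fst T Z)
  rw [MonoidalClosed.uncurry_eq, MonoidalClosed.uncurry_eq]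
  have e (k : Z ⟶ (ihom T).obj X) : T ◁ k = lift (fst T Z) (snd T Z ≫ k) := by ext <;> simp
  rw [e, e]
  exact this

variable [HasPullbacks E]

/-- The object of Euler reals: the pullback of `ev : T^T ⟶ T` along `o : 1 ⟶ T`. -/
def EulerReals : E := pullback (evalAt T o T) o

namespace EulerReals

/-- The inclusion of the Euler reals into `T^T`. -/
def incl : EulerReals T o ⟶ (ihom T).obj T := pullback.fst _ _

theorem incl_evalAt {Z : E} (f : Z ⟶ EulerReals T o) :
    applyAt (f ≫ incl T o) (toUnit Z ≫ o) = toUnit Z ≫ o := by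
  have h : incl T o ≫ evalAt T o T = toUnit _ ≫ o :=
    pullback.condition.trans (congrArg (· ≫ o) (toUnit_unique _ _))
  rw [← comp_evalAt, Category.assoc, h, comp_toUnit_assoc]

variable {T o} in
theorem ext_incl {Z : E} {f g : Z ⟶ EulerReals T o} (h : f ≫ incl T o = g ≫ incl T o) : f = g :=
  pullback.hom_ext h (toUnit_unique _ _)

/-- The unit of the monoid of Euler reals: the identity of `T`. -/
def one : 𝟙_ E ⟶ EulerReals T o :=
  pullback.lift (MonoidalClosed.id T) (toUnit _) (by
    rw [comp_evalAt, ← Category.id_comp (MonoidalClosed.id T), applyAt_id])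

/-- The multiplication of Euler reals: the restriction of the internal composition of `T^T`. -/
def mul : EulerReals T o ⊗ EulerReals T o ⟶ EulerReals T o :=
  pullback.lift ((incl T o ⊗ₘ incl T o) ≫ endComp T) (toUnit _) (by
    have h : incl T o ⊗ₘ incl T o = lift (fst _ _ ≫ incl T o) (snd _ _ ≫ incl T o) := by ext <;> simp
    rw [comp_evalAt, h, applyAt_endComp, incl_evalAt, incl_evalAt])

theorem one_incl : one T o ≫ incl T o = MonoidalClosed.id T := pullback.lift_fst _ _ _

theorem mul_incl : mul T o ≫ incl T o = (incl T o ⊗ₘ incl T o) ≫ endComp T := pullback.lift_fst _ _ _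

variable {T o} in
theorem lift_mul_incl {Z : E} (g f : Z ⟶ EulerReals T o) :
    (lift g f ≫ mul T o) ≫ incl T o = lift (g ≫ incl T o) (f ≫ incl T o) ≫ endComp T := by
  rw [Category.assoc, mul_incl]; simp

/-- The monoid structure of the object of Euler reals. -/
instance : MonObj (EulerReals T o) where
  one := one T o
  mul := mul T o
  one_mul := by
    refine ext_incl (ihom_ext fun y t => ?_)
    have h : one T o ▷ EulerReals T o = lift (toUnit _ ≫ one T o) (snd _ _) := by
      ext
      · rw [whiskerRight_fst, lift_fst]; exact congrArg (· ≫ _) (toUnit_unique _ _)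
      · simp
    rw [h, lift_mul_incl, comp_lift_assoc, applyAt_endComp]
    rw [Category.assoc, one_incl, ← Category.assoc y, applyAt_id, leftUnitor_hom]
  mul_one := by
    refine ext_incl (ihom_ext fun y t => ?_)
    have h : EulerReals T o ◁ one T o = lift (fst _ _) (toUnit _ ≫ one T o) := by
      ext
      · simp
      · rw [whiskerLeft_snd, lift_snd]; exact congrArg (· ≫ _) (toUnit_unique _ _)
    rw [h, lift_mul_incl, comp_lift_assoc, applyAt_endComp]
    rw [Category.assoc, one_incl, ← Category.assoc y (toUnit _), applyAt_id,
      rightUnitor_hom]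
  mul_assoc := by
    refine ext_incl (ihom_ext fun y t => ?_)
    have h1 : mul T o ▷ EulerReals T o =
        lift (lift (fst _ _ ≫ fst _ _) (fst _ _ ≫ snd _ _) ≫ mul T o) (snd _ _) := by
      ext <;> simp [← comp_lift]
    have h2 : (α_ _ _ _).hom ≫ EulerReals T o ◁ mul T o =
        lift (fst _ _ ≫ fst _ _) (lift (fst _ _ ≫ snd _ _) (snd _ _) ≫ mul T o) := by
      ext
      · simp
      · have : (α_ (EulerReals T o) (EulerReals T o) (EulerReals T o)).hom ≫ snd _ _ =
            lift (fst _ _ ≫ snd _ _) (snd _ _) := by ext <;> simp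
        simp [← this]
    rw [h1, reassoc_of% h2]
    rw [lift_mul_incl, lift_mul_incl, lift_mul_incl, lift_mul_incl]
    simp only [comp_lift_assoc, applyAt_endComp]

end EulerReals

end EulerReals

section Monoid

variable [HasEqualizers E] (M : E) [MonObj M]

/-- The object of invertible elements of a monoid `M`: the object of pairs
`(x, y)` with `x y = 1 = y x`. -/
def Invertibles : E :=
  equalizer (lift (fst M M * snd M M) (snd M M * fst M M)) (lift 1 1)

/-- The inclusion `U ⟶ M × M`, `(x, y) ↦ (x, y)`. -/
def Invertibles.pair : Invertibles M ⟶ M ⊗ M := equalizer.ι _ _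

/-- The inclusion `U ⟶ M`, `(x, y) ↦ x`. -/
def Invertibles.incl : Invertibles M ⟶ M := pair M ≫ fst M M

theorem Invertibles.mul_eq_one {Z : E} (k : Z ⟶ Invertibles M) :
    (k ≫ pair M ≫ fst M M) * (k ≫ pair M ≫ snd M M) = 1 ∧
      (k ≫ pair M ≫ snd M M) * (k ≫ pair M ≫ fst M M) = 1 := by
  have c : pair M ≫ lift (fst M M * snd M M) (snd M M * fst M M) = pair M ≫ lift 1 1 :=
    equalizer.condition _ _
  rw [comp_lift, comp_lift] at c
  have c1 := congrArg (k ≫ ·) (c =≫ fst M M)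
  have c2 := congrArg (k ≫ ·) (c =≫ snd M M)
  simp only [lift_fst, lift_snd, MonObj.comp_mul, MonObj.comp_one] at c1 c2
  exact ⟨c1, c2⟩

/-- An element has at most one inverse, so the invertible elements form a subobject of `M`. -/
instance : Mono (Invertibles.incl M) where
  right_cancellation {Z} f g h := by
    have hf : f ≫ Invertibles.pair M = g ≫ Invertibles.pair M := by
      ext
      · simpa [Invertibles.incl] using h
      · have h1 := (Invertibles.mul_eq_one M f).2
        rw [show f ≫ Invertibles.pair M ≫ fst M M = g ≫ Invertibles.pair M ≫ fst M M from h] at h1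
        simpa using left_inv_eq_right_inv h1 (Invertibles.mul_eq_one M g).1
    exact equalizer.hom_ext hf

/-- `M` is bi-directional with respect to `π₀` if `π₀ U = 1 + 1`, for `U` the object of
invertible elements of `M`. -/
def IsBidirectional {S : Type*} [Category* S] [HasTerminal S] [HasBinaryCoproducts S]
    (π₀ : E ⥤ S) : Prop :=
  Nonempty (π₀.obj (Invertibles M) ≅ (⊤_ S) ⨿ (⊤_ S))

end Monoid

/-- `X` is connected with respect to `π₀` if `π₀ X = 1`. -/
def IsConnectedObj {S : Type*} [Category* S] [HasTerminal S] (π₀ : E ⥤ S) (X : E) : Prop :=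
  Nonempty (π₀.obj X ≅ ⊤_ S)

section KL

variable [BraidedCategory E] [HasEqualizers E] (R : E) [CommRingObj R]

open scoped CommRingObj RingObj

/-- The object `D` of elements of square zero of a ring `R`. -/
def SquareZero : E := equalizer (𝟙 R * 𝟙 R) 0

/-- The inclusion `D ⟶ R`. -/
def SquareZero.incl : SquareZero R ⟶ R := equalizer.ι _ _

/-- The map `R × R ⟶ R^D` which sends `(a, b)` to `d ↦ a + b d`. -/
def klMap [Closed (SquareZero R)] : R ⊗ R ⟶ (ihom (SquareZero R)).obj R :=
  MonoidalClosed.curry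
    (snd _ _ ≫ fst R R + (snd _ _ ≫ snd R R) * (fst _ _ ≫ SquareZero.incl R))

/-- The Kock-Lawvere axiom: `R × R ⟶ R^D` is an isomorphism (`R` is a ring of line type). -/
def KockLawvere [Closed (SquareZero R)] : Prop := IsIso (klMap R)

end KL

/-! ### Pre-cohesive geometric morphisms -/

section PreCohesive

variable {S : Type*} [Category* S] [CartesianMonoidalCategory S] [MonoidalClosed S]
  [MonoidalClosed E]

/-- The comparison map `F (X^A) ⟶ (F X)^(F A)`, the transpose of
`F A × F (X^A) ≅ F (A × X^A) ⟶ F X`. -/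
def expComparisonMap (F : S ⥤ E) [PreservesFiniteLimits F] (A X : S) :
    F.obj ((ihom A).obj X) ⟶ (ihom (F.obj A)).obj (F.obj X) :=
  MonoidalClosed.curry (inv (prodComparison F A ((ihom A).obj X)) ≫ F.map ((ihom.ev A).app X))

/-- An adjunction `p^* ⊣ p_*`, between the toposes `S` and `E`, is a pre-cohesive geometric
morphism `p : E ⟶ S` if it is hyperconnected, `p^*` is cartesian closed and `p_*` preserves
coequalizers. -/
structure IsPreCohesive {F : S ⥤ E} {G : E ⥤ S} (adj : F ⊣ G) : Prop where
  [preservesFiniteLimits : PreservesFiniteLimits F]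
  full : F.Full
  faithful : F.Faithful
  mono_counit : ∀ X : E, Mono (adj.counit.app X)
  isIso_expComparisonMap : ∀ A X : S, IsIso (expComparisonMap F A X)
  preservesCoequalizers : PreservesColimitsOfShape WalkingParallelPair G

end PreCohesive

end Generic

/-! ### Ring objects in presheaf categories -/

/-- A presheaf of commutative rings is a commutative ring object. -/
@[reducible]
def commRingObjOfPresheaf {C : Type u} [Category.{v} C] (F : C ⥤ Type)
    [∀ X, CommRing (F.obj X)]
    (map_zero : ∀ {X Y : C} (f : X ⟶ Y), F.map f (0 : F.obj X) = (0 : F.obj Y))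
    (map_one : ∀ {X Y : C} (f : X ⟶ Y), F.map f (1 : F.obj X) = (1 : F.obj Y))
    (map_neg : ∀ {X Y : C} (f : X ⟶ Y) (a : F.obj X), F.map f (-a) = -F.map f a)
    (map_add : ∀ {X Y : C} (f : X ⟶ Y) (a b : F.obj X), F.map f (a + b) = F.map f a + F.map f b)
    (map_mul : ∀ {X Y : C} (f : X ⟶ Y) (a b : F.obj X), F.map f (a * b) = F.map f a * F.map f b) :
    CommRingObj F where
  zero := { app X := TypeCat.ofHom fun _ => (0 : F.obj X),
            naturality _ _ f := by ext; exact (map_zero f).symm }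
  one := { app X := TypeCat.ofHom fun _ => (1 : F.obj X),
            naturality _ _ f := by ext; exact (map_one f).symm }
  neg := { app X := TypeCat.ofHom fun a => -a,
            naturality _ _ f := by ext a; exact (map_neg f a).symm }
  add := { app X := TypeCat.ofHom fun a => a.1 + a.2,
            naturality _ _ f := by ext a; exact (map_add f a.1 a.2).symm }
  mul := { app X := TypeCat.ofHom fun a => a.1 * a.2,
            naturality _ _ f := by ext a; exact (map_mul f a.1 a.2).symm }
  zero_add := by ext X a; exact zero_add a.2
  add_zero := by ext X a; exact add_zero a.1
  add_assoc := by ext X a; exact add_assoc a.1.1 a.1.2 a.2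
  one_mul := by ext X a; exact one_mul a.2
  mul_one := by ext X a; exact mul_one a.1
  mul_assoc := by ext X a; exact mul_assoc a.1.1 a.1.2 a.2
  left_neg := by ext X a; exact neg_add_cancel a
  right_neg := by ext X a; exact add_neg_cancel a
  add_comm := by ext X a; exact add_comm a.2 a.1
  mul_comm := by ext X a; exact mul_comm a.2 a.1
  mul_add := by ext X a; exact mul_add a.1 a.2.1 a.2.2
  add_mul := by ext X a; exact add_mul a.1.1 a.1.2 a.2

/-! ### The pointed object `T` and the ring `R` -/

/-- The `C^∞`-ring of functions of an object of the site. -/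
abbrev Site.algebra (X : Site) : CInftyRingCat := X.unop.obj

/-- `Spec A`, for an object `A` of the category of algebras defining the site. -/
abbrev Site.spec (A : CInftyRingCat) (hA : A.IsSiteAlgebra) : Site := Opposite.op ⟨A, hA⟩

/-- Maps `X ⟶ Spec A` correspond to morphisms of `C^∞`-rings from `A` to the algebra of `X`. -/
def Site.homSpecEquiv (X : Site) (A : CInftyRingCat) (hA : A.IsSiteAlgebra) :
    (X ⟶ Site.spec A hA) ≃ CInftyHom A X.algebra where
  toFun f := f.unop.hom.hom
  invFun φ := Quiver.Hom.op ⟨⟨φ⟩⟩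
  left_inv _ := rfl
  right_inv _ := rfl

/-- `T = Spec ℝ[ε]` as an object of the presheaf topos. -/
def T : Psh := yoneda.obj (Site.spec ⟨DualNumber ℝ⟩ CInftyRingCat.isSiteAlgebra_dual)

/-- The point `0 : 1 ⟶ T`, which corresponds to the morphism `ℝ[ε] → ℝ` with `ε ↦ 0`. -/
def T.zero : 𝟙_ Psh ⟶ T where
  app X := TypeCat.ofHom fun _ =>
    (X.unop.homSpecEquiv _ _).symm ((constHom X.unop.algebra).comp dualFst)
  naturality X Y f := by
    ext x
    apply (Y.unop.homSpecEquiv _ _).injective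
    apply CInftyHom.ext
    funext a
    exact ((f.unop.unop.hom.hom.toAlgHom).commutes _).symm

/-- `R = Spec C^∞(ℝ)` as an object of the presheaf topos. -/
def R : Psh := yoneda.obj (Site.spec ⟨smoothLine⟩ CInftyRingCat.isSiteAlgebra_smoothLine)

/-- Maps `X ⟶ R` correspond to elements of the algebra of `X`. -/
def R.equiv (X : Siteᵒᵖ) : R.obj X ≃ X.unop.algebra :=
  (X.unop.homSpecEquiv _ _).trans (smoothLine.homEquiv _)

theorem R.equiv_map {X Y : Siteᵒᵖ} (f : X ⟶ Y) (r : R.obj X) :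
    R.equiv Y (R.map f r) = f.unop.unop.hom.hom.toAlgHom (R.equiv X r) := rfl

instance (X : Siteᵒᵖ) : CommRing (R.obj X) := (R.equiv X).commRing

/-- The ring structure of `R` induced by the smooth maps
`+, · : ℝ² → ℝ`: on maps `X ⟶ R` it is the ring structure of the algebra of `X`. -/
instance : CommRingObj R :=
  commRingObjOfPresheaf R
    (fun f => by
      apply (R.equiv _).injective; rw [R.equiv_map]
      simp [-CInftyHom.toAlgHom_apply, Equiv.zero_def])
    (fun f => by
      apply (R.equiv _).injective; rw [R.equiv_map]
      simp [-CInftyHom.toAlgHom_apply, Equiv.one_def])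
    (fun f a => by
      apply (R.equiv _).injective; rw [R.equiv_map]
      simp [-CInftyHom.toAlgHom_apply, Equiv.neg_def, R.equiv_map])
    (fun f a b => by
      apply (R.equiv _).injective; rw [R.equiv_map]
      simp [-CInftyHom.toAlgHom_apply, Equiv.add_def, R.equiv_map])
    (fun f a b => by
      apply (R.equiv _).injective; rw [R.equiv_map]
      simp [-CInftyHom.toAlgHom_apply, Equiv.mul_def, R.equiv_map])

/-- The inclusion `T ⟶ R`, which corresponds to the morphism `C^∞(ℝ) → ℝ[ε]` with `X ↦ ε`. -/
def T.incl : T ⟶ R :=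
  yoneda.map (((Site.spec ⟨DualNumber ℝ⟩ CInftyRingCat.isSiteAlgebra_dual).homSpecEquiv
    ⟨smoothLine⟩ CInftyRingCat.isSiteAlgebra_smoothLine).symm
    ((smoothLine.homEquiv (DualNumber ℝ)).symm DualNumber.eps))

/-! ### The canonical geometric morphism to sets -/

/-- The inverse image `p^*`: constant presheaves. -/
abbrev discrete : Type ⥤ Psh := Functor.const Siteᵒᵖ

/-- The direct image `p_*`: global sections, that is, limits of presheaves. -/
abbrev points : Psh ⥤ Type := lim

/-- The left adjoint `p_!` of `p^*`: connected components, that is, colimits of presheaves. -/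
abbrev components : Psh ⥤ Type := colim

/-- The adjunction `p^* ⊣ p_*` of the canonical geometric morphism from presheaves to sets. -/
abbrev pointsAdj : discrete ⊣ points := constLimAdj

/-- The adjunction `p_! ⊣ p^*`. -/
abbrev componentsAdj : components ⊣ discrete := colimConstAdj

end RSDG

end

noncomputable section

namespace RSDG

open CInftyRing

universe u v

/-! ### Smooth functions -/

section Smooth

open MeasureTheory

/-! Each assertion reduces to a fact about the algebras of the site.

`ℝ` is the initial algebra, so `p_*` is evaluation at `ℝ`; evaluation at an object has a right
adjoint, and therefore `p_*` preserves coequalizers. Every algebra `A` has a morphism to `ℝ`, which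
makes the counit `F(ℝ) → F(Spec A)` a split monomorphism. The algebras have binary coproducts, so
colimits indexed by them are sifted and `p_!` preserves finite products. A natural map from a
constant presheaf times a representable to a constant presheaf ignores the representable factor, so
`p^*` preserves exponentials. The substantial input is the coproduct of `A` and `B`: smooth
functions in the generators of both, restricted to pairs of near-points (`NearPointRing`, `Coprod`).
It is `W`-determined by construction. It is connected because an idempotent is constant on real
points, and a Weil algebra has no nonzero nilpotent idempotent (`Coprod.isConnected`).

For the Kock-Lawvere axiom, an element of `R^D` over `A` is an element of the coproduct of `A` and
`ℝ[ε]`. Hadamard's lemma writes it as `a + b ε`; extending near-points `A → W` to `W[ε]` shows that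
`a` and `b` are unique. Both `T` and `D` classify elements of square zero, so `R^T` has the same
description. An endomap of `T` is then `t ↦ a + b t`; fixing `0` forces `a = 0`, and every `b`
occurs because `b t` again has square zero. Composition multiplies the slopes, which identifies the
Euler reals with `(R, ·)`.

Invertible elements of a connected algebra have the form `± exp a`: a smooth substitute for `log
|x|` near the hyperbola `x y = 1` reduces this to `w² = 1`, where `(1 + w) / 2` is idempotent
(`exists_log`, `exists_eq_cexp`). Hence every unit is a restriction of one of the two generic units
`± exp X` over `C^∞(ℝ)`. The sign is detected at any real point, so there are exactly two
components. `R` is connected because it is representable. -/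

/-- Integrals over `[0, 1]` of smooth functions depend smoothly on parameters. -/
theorem contDiff_integral_unitInterval {P : Type*} [NormedAddCommGroup P] [NormedSpace ℝ P]
    {F : P × ℝ → ℝ} (hF : ContDiff ℝ ∞ F) :
    ContDiff ℝ ∞ fun p => ∫ u in (0 : ℝ)..1, F (p, u) := by
  -- The integral is the value at `0` of the convolution of the indicator of `[-1, 0)` with `χ F(p,
  -- ·)`, and only the second factor of a convolution has to be smooth. The radii make `χ = 1` on
  -- `[-2, 2] ⊇ [0, 1]`, with support in `[-3, 3]`.
  let χ : ContDiffBump (0 : ℝ) := ⟨2, 3, by norm_num, by norm_num⟩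
  have hg : ContDiff ℝ ∞ (fun q : P × ℝ => χ q.2 * F q) := (χ.contDiff.comp contDiff_snd).mul hF
  have h := contDiffOn_convolution_right_with_param (n := ⊤)
    (f := Set.indicator (Set.Ico (-1 : ℝ) 0) fun _ => (1 : ℝ))
    (g := fun p u => χ u * F (p, u)) (μ := volume) (s := Set.univ)
    (ContinuousLinearMap.mul ℝ ℝ) isOpen_univ (isCompact_closedBall (0 : ℝ) 3)
    (fun p x _ hx => by
      have : χ x = 0 := χ.zero_of_le_dist (by
        simp only [Metric.mem_closedBall, not_le] at hx
        exact hx.le)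
      simp [this])
    (((locallyIntegrable_const (1 : ℝ)).indicator measurableSet_Ico)) (by
      simpa [Function.HasUncurry.uncurry] using hg.contDiffOn)
  rw [Set.univ_prod_univ, contDiffOn_univ] at h
  have h2 := h.comp (contDiff_id.prodMk (contDiff_const (c := (0 : ℝ))) :
    ContDiff ℝ ∞ fun p : P => (p, (0 : ℝ)))
  convert h2 using 1
  funext p
  symm
  simp only [Function.comp_apply, convolution_def, zero_sub, ContinuousLinearMap.mul_apply']
  have h3 : ∀ t : ℝ, (Set.Ico (-1 : ℝ) 0).indicator (fun _ => (1 : ℝ)) t * (χ (-t) * F (p, -t)) =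
      (Set.Ico (-1 : ℝ) 0).indicator (fun t => F (p, -t)) t := by
    intro t
    by_cases ht : t ∈ Set.Ico (-1 : ℝ) 0
    · have : χ (-t) = 1 := χ.one_of_mem_closedBall (by
        simp only [Metric.mem_closedBall, dist_zero_right, norm_neg, Real.norm_eq_abs]
        rw [abs_le]; constructor <;> linarith [ht.1, ht.2, show χ.rIn = 2 from rfl])
      simp [ht, this]
    · simp [ht]
  simp_rw [id, h3]
  rw [integral_indicator measurableSet_Ico, integral_Ico_eq_integral_Ioc,
    ← intervalIntegral.integral_of_le (by norm_num : (-1 : ℝ) ≤ 0),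
    intervalIntegral.integral_comp_neg (fun t => F (p, t))]
  simp

/-- Hadamard's lemma, in one variable and with parameters. -/
theorem hadamard {P : Type*} [NormedAddCommGroup P] [NormedSpace ℝ P]
    {F : P × ℝ → ℝ} (hF : ContDiff ℝ ∞ F) :
    ∃ G : P × ℝ → ℝ, ContDiff ℝ ∞ G ∧ ∀ p s, F (p, s) = F (p, 0) + s * G (p, s) := by
  have hd : ContDiff ℝ ∞ fun q : P × ℝ => fderiv ℝ F q (0, 1) :=
    (hF.fderiv_right (m := ∞) (by simp)).clm_apply contDiff_const
  -- The quotient is the mean of `∂F/∂s` along the segment from `(p, 0)` to `(p, s)`.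
  refine ⟨fun q => ∫ u in (0 : ℝ)..1, fderiv ℝ F (q.1, u * q.2) (0, 1),
    contDiff_integral_unitInterval
      (F := fun q : (P × ℝ) × ℝ => fderiv ℝ F (q.1.1, q.2 * q.1.2) (0, 1))
      (hd.comp (f := fun q : (P × ℝ) × ℝ => (q.1.1, q.2 * q.1.2)) (by fun_prop)), fun p s => ?_⟩
  have hder (u : ℝ) : HasDerivAt (fun u : ℝ => F (p, u * s)) (s * fderiv ℝ F (p, u * s) (0, 1)) u := by
    have h1 : HasDerivAt (fun u : ℝ => (p, u * s)) ((0 : P), s) u :=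
      (hasDerivAt_const u p).prodMk (by simpa using (hasDerivAt_id u).mul_const s)
    have h2 := ((hF.differentiable (by simp)) (p, u * s)).hasFDerivAt.comp_hasDerivAt u h1
    have h3 : ((0 : P), s) = s • ((0 : P), (1 : ℝ)) := by simp
    rw [h3, map_smul, smul_eq_mul] at h2
    exact h2
  have hc : Continuous fun u : ℝ => s * fderiv ℝ F (p, u * s) (0, 1) :=
    continuous_const.mul (hd.continuous.comp (by fun_prop : Continuous fun u : ℝ => (p, u * s)))
  have h := intervalIntegral.integral_eq_sub_of_hasDerivAt (a := 0) (b := 1) (fun u _ => hder u)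
    (hc.intervalIntegrable _ _)
  rw [intervalIntegral.integral_const_mul] at h
  simp only [one_mul, zero_mul] at h
  linarith

/-- A smooth function which vanishes near the zeros of `g` is a multiple of `g`. -/
theorem contDiff_div_of_eventually {E : Type*} [NormedAddCommGroup E] [NormedSpace ℝ E]
    {F g : E → ℝ} (hF : ContDiff ℝ ∞ F) (hg : ContDiff ℝ ∞ g)
    (h : ∀ x, g x = 0 → ∀ᶠ y in nhds x, F y = 0) : ContDiff ℝ ∞ fun x => F x / g x := by
  rw [contDiff_iff_contDiffAt]
  intro x
  by_cases hx : g x = 0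
  · refine (contDiffAt_const (c := (0 : ℝ))).congr_of_eventuallyEq ?_
    filter_upwards [h x hx] with y hy
    simp [hy]
  · exact hF.contDiffAt.div hg.contDiffAt hx

end Smooth

/-! ### Free `C^∞`-rings -/

namespace SmoothFn

variable {n : ℕ}

@[ext]
theorem ext {f g : SmoothFn n} (h : ∀ x, f x = g x) : f = g := Subtype.ext (funext h)

/-- The algebra `C^∞(ℝⁿ)`, as a subalgebra of the algebra of all functions. -/
def subalgebra (n : ℕ) : Subalgebra ℝ ((Fin n → ℝ) → ℝ) where
  carrier := {f | ContDiff ℝ ∞ f}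
  mul_mem' {f g} (hf : ContDiff ℝ ∞ f) (hg : ContDiff ℝ ∞ g) := hf.mul hg
  add_mem' {f g} (hf : ContDiff ℝ ∞ f) (hg : ContDiff ℝ ∞ g) := hf.add hg
  algebraMap_mem' r := (contDiff_const : ContDiff ℝ ∞ fun _ => r)

instance : CommRing (SmoothFn n) := inferInstanceAs (CommRing (subalgebra n))

instance : Algebra ℝ (SmoothFn n) := inferInstanceAs (Algebra ℝ (subalgebra n))

@[simp] theorem comp_apply {m : ℕ} (f : SmoothFn m) (g : Fin m → SmoothFn n) (x) :
    f.comp g x = f fun i => g i x := rfl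

instance : CInftyRing (SmoothFn n) where
  op f a := f.comp a
  op_proj _ _ := rfl
  op_comp _ _ _ := rfl
  op_add _ := rfl
  op_mul _ := rfl
  op_const _ _ := rfl

theorem op_eq_comp {m : ℕ} (f : SmoothFn m) (a : Fin m → SmoothFn n) : op f a = f.comp a := rfl

variable {A : Type*} [CommRing A] [Algebra ℝ A] [CInftyRing A]

/-- Evaluation at a point of a `C^∞`-ring: `C^∞(ℝⁿ)` is the free `C^∞`-ring. -/
def evalAt (a : Fin n → A) : CInftyHom (SmoothFn n) A := ⟨fun f => op f a, fun f g => op_comp f g a⟩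

@[simp] theorem evalAt_apply (a : Fin n → A) (f : SmoothFn n) : evalAt a f = op f a := rfl

end SmoothFn

section Op

variable {n : ℕ} {A : Type*} [CommRing A] [Algebra ℝ A] [CInftyRing A] (a : Fin n → A)

theorem op_add' (f g : SmoothFn n) : op (f + g) a = op f a + op g a :=
  map_add (SmoothFn.evalAt a).toAlgHom f g

theorem op_mul' (f g : SmoothFn n) : op (f * g) a = op f a * op g a :=
  map_mul (SmoothFn.evalAt a).toAlgHom f g

theorem op_sub' (f g : SmoothFn n) : op (f - g) a = op f a - op g a :=
  map_sub (SmoothFn.evalAt a).toAlgHom f g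

theorem op_one' : op (1 : SmoothFn n) a = 1 := map_one (SmoothFn.evalAt a).toAlgHom

theorem op_zero' : op (0 : SmoothFn n) a = 0 := map_zero (SmoothFn.evalAt a).toAlgHom

end Op

theorem op_real {n : ℕ} (f : SmoothFn n) (x : Fin n → ℝ) : op f x = f x := rfl

/-- Precomposition of a smooth function with a reindexing of its variables. -/
def SmoothFn.rename {m n : ℕ} (σ : Fin m → Fin n) (f : SmoothFn m) : SmoothFn n :=
  f.comp fun i => SmoothFn.proj (σ i)

@[simp] theorem op_rename {m n : ℕ} {A : Type*} [CommRing A] [Algebra ℝ A] [CInftyRing A]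
    (σ : Fin m → Fin n) (f : SmoothFn m) (a : Fin n → A) : op (f.rename σ) a = op f fun i => a (σ i) := by
  rw [SmoothFn.rename, CInftyRing.op_comp]
  simp only [CInftyRing.op_proj]

/-- The expansion of a smooth function to the second order in its last variable. -/
theorem SmoothFn.exists_taylor {n : ℕ} (f : SmoothFn (n + 1)) :
    ∃ (f₀ f₁ : SmoothFn n) (f₂ : SmoothFn (n + 1)),
      f = f₀.rename (Fin.castAdd 1) + SmoothFn.proj (Fin.natAdd n 0) * f₁.rename (Fin.castAdd 1) +
        SmoothFn.proj (Fin.natAdd n 0) * SmoothFn.proj (Fin.natAdd n 0) * f₂ := by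
  let ι : (Fin n → ℝ) × ℝ → (Fin (n + 1) → ℝ) := fun q => Fin.append q.1 fun _ => q.2
  have hι : ContDiff ℝ ∞ ι := contDiff_pi.2 fun i => by
    refine Fin.addCases (fun j => ?_) (fun j => ?_) i
    · simp only [ι, Fin.append_left]; fun_prop
    · simp only [ι, Fin.append_right]; fun_prop
  let κ : (Fin (n + 1) → ℝ) → (Fin n → ℝ) × ℝ :=
    fun x => (fun i => x (Fin.castAdd 1 i), x (Fin.natAdd n 0))
  have hκ : ContDiff ℝ ∞ κ := by fun_prop
  have hικ (x) : ι (κ x) = x := by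
    funext i
    refine Fin.addCases (fun j => ?_) (fun j => ?_) i
    · simp [ι, κ]
    · simp only [ι, κ, Fin.append_right]; congr; omega
  obtain ⟨G, hG, h1⟩ := hadamard (F := fun q => f (ι q)) (f.2.comp hι)
  -- A second application, to the first quotient, produces the quadratic remainder.
  obtain ⟨H, hH, h2⟩ := hadamard hG
  refine ⟨⟨fun x => f (ι (x, 0)), f.2.comp (hι.comp (by fun_prop))⟩,
    ⟨fun x => G (x, 0), hG.comp (by fun_prop)⟩, ⟨fun x => H (κ x), hH.comp hκ⟩, ?_⟩
  ext x
  have h3 := h1 (κ x).1 (κ x).2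
  rw [h2, Prod.mk.eta, hικ] at h3
  rw [h3]
  change _ = f (ι ((κ x).1, 0)) + (κ x).2 * G ((κ x).1, 0) + (κ x).2 * (κ x).2 * H (κ x)
  ring

/-- A smooth operation is affine along square zero elements. -/
theorem SmoothFn.exists_op_append_eq {n : ℕ} (f : SmoothFn (n + 1)) :
    ∃ f₀ f₁ : SmoothFn n, ∀ {A : Type u} [CommRing A] [Algebra ℝ A] [CInftyRing A] (a : Fin n → A)
      (d : A), d * d = 0 → op f (Fin.append a fun _ => d) = op f₀ a + d * op f₁ a := by
  obtain ⟨f₀, f₁, f₂, h⟩ := f.exists_taylor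
  refine ⟨f₀, f₁, fun a d hd => ?_⟩
  rw [h]
  simp [op_add', op_mul', CInftyRing.op_proj, hd]


/-! ### Morphisms of `C^∞`-rings -/

namespace CInftyHom

variable {A B C : Type*} [CommRing A] [Algebra ℝ A] [CInftyRing A]
  [CommRing B] [Algebra ℝ B] [CInftyRing B] [CommRing C] [Algebra ℝ C] [CInftyRing C]

instance : AlgHomClass (CInftyHom A B) ℝ A B where
  map_mul φ := map_mul φ.toAlgHom
  map_one φ := map_one φ.toAlgHom
  map_add φ := map_add φ.toAlgHom
  map_zero φ := map_zero φ.toAlgHom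
  commutes φ := φ.toAlgHom.commutes

@[simp] theorem comp_apply (ψ : CInftyHom B C) (φ : CInftyHom A B) (x : A) :
    ψ.comp φ x = ψ (φ x) := rfl


theorem hom_ext {φ ψ : CInftyHom A B} (h : ∀ x, φ x = ψ x) : φ = ψ := DFunLike.ext _ _ h

theorem ext_of_generators {n : ℕ} {g : Fin n → A} (hg : ∀ a : A, ∃ f : SmoothFn n, op f g = a)
    {φ ψ : CInftyHom A B} (h : ∀ i, φ (g i) = ψ (g i)) : φ = ψ := by
  refine hom_ext fun x => ?_
  obtain ⟨f, rfl⟩ := hg x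
  simp only [map_op, h]

/-- The morphism which sends generators `g` to `b`, if `b` satisfies the relations between
the generators. -/
def lift {n : ℕ} {g : Fin n → A} (hg : ∀ a : A, ∃ f : SmoothFn n, op f g = a) (b : Fin n → B)
    (hb : ∀ f f' : SmoothFn n, op f g = op f' g → op f b = op f' b) : CInftyHom A B where
  toFun a := op (hg a).choose b
  map_op' {m} f a := by
    rw [← CInftyRing.op_comp]
    refine hb _ _ ?_
    rw [(hg _).choose_spec, CInftyRing.op_comp]
    exact congrArg (op f) (funext fun i => (hg (a i)).choose_spec.symm)

theorem lift_op {n : ℕ} {g : Fin n → A} (hg : ∀ a : A, ∃ f : SmoothFn n, op f g = a)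
    (b : Fin n → B) (hb : ∀ f f' : SmoothFn n, op f g = op f' g → op f b = op f' b)
    (f : SmoothFn n) : lift hg b hb (op f g) = op f b :=
  hb _ _ (hg _).choose_spec

@[simp] theorem lift_generator {n : ℕ} {g : Fin n → A}
    (hg : ∀ a : A, ∃ f : SmoothFn n, op f g = a)
    (b : Fin n → B) (hb : ∀ f f' : SmoothFn n, op f g = op f' g → op f b = op f' b)
    (i : Fin n) : lift hg b hb (g i) = b i := by
  have := lift_op hg b hb (SmoothFn.proj i)
  rwa [CInftyRing.op_proj, CInftyRing.op_proj] at this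

/-- A homomorphism of algebras to `ℝ` commutes with all smooth operations: otherwise
`(f - φ (f a))² + ∑ (xᵢ - φ aᵢ)²` would be a positive function, hence invertible,
whose value at `a` is in the kernel of `φ`. -/
def ofAlgHom (φ : A →ₐ[ℝ] ℝ) : CInftyHom A ℝ where
  toFun := φ
  map_op' {n} f a := by
    by_contra hne
    rw [op_real] at hne
    let q : SmoothFn n := f - SmoothFn.const (φ (op f a))
    let r (i : Fin n) : SmoothFn n := SmoothFn.proj i - SmoothFn.const (φ (a i))
    let g : SmoothFn n := q * q + ∑ i, r i * r i
    have hg' (x : Fin n → ℝ) : g x = q x * q x + ∑ i, r i x * r i x := by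
      have h := map_sum (SmoothFn.evalAt x).toAlgHom (fun i => r i * r i) Finset.univ
      exact congrArg (q x * q x + ·) h
    have hg (x : Fin n → ℝ) : g x ≠ 0 := by
      rw [hg']
      intro h0
      have hs : 0 ≤ ∑ i, r i x * r i x := Finset.sum_nonneg fun i _ => mul_self_nonneg _
      have h1 : q x * q x = 0 := by nlinarith [mul_self_nonneg (q x)]
      have h2 : ∑ i, r i x * r i x = 0 := by nlinarith [mul_self_nonneg (q x)]
      rw [Finset.sum_eq_zero_iff_of_nonneg fun i _ => mul_self_nonneg _] at h2
      have h3 : x = fun i => φ (a i) := funext fun i =>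
        sub_eq_zero.1 (mul_self_eq_zero.1 (h2 i (Finset.mem_univ i)))
      exact hne ((sub_eq_zero.1 (mul_self_eq_zero.1 h1)).symm.trans (congrArg f h3))
    let k : SmoothFn n := ⟨fun x => (g x)⁻¹, g.2.inv hg⟩
    have hgk : g * k = 1 := SmoothFn.ext fun x => mul_inv_cancel₀ (hg x)
    have h1 : φ (op g a) * φ (op k a) = 1 := by rw [← map_mul, ← op_mul', hgk, op_one', map_one]
    have hq : φ (op q a) = 0 := by simp [q, op_sub', op_const']
    have hr (i) : φ (op (r i) a) = 0 := by simp [r, op_sub', op_const', CInftyRing.op_proj]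
    have h2 : op g a = op q a * op q a + ∑ i, op (r i) a * op (r i) a := by
      simp only [g, op_add', op_mul']
      congr 1
      rw [← SmoothFn.evalAt_apply, map_sum]
      simp [op_mul']
    rw [h2] at h1
    simp [hq, hr] at h1

end CInftyHom

namespace CInftyRingCat

/-- The augmentation of a Weil algebra is only given as an algebra homomorphism;
`CInftyHom.ofAlgHom` makes it a morphism of `C^∞`-rings, so that it can be composed with
near-points. -/
theorem IsWeil.exists_hom {W : CInftyRingCat} (hW : W.IsWeil) :
    ∃ φ : CInftyHom W ℝ, ∀ a : W, φ a = 0 → IsNilpotent a :=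
  hW.2.imp' CInftyHom.ofAlgHom fun _ h => h

theorem IsWeil.eq_zero_of_idempotent {W : CInftyRingCat} {φ : CInftyHom W ℝ}
    (hφ : ∀ a : W, φ a = 0 → IsNilpotent a) {e : W} (he : IsIdempotentElem e) (h : φ e = 0) :
    e = 0 := by
  obtain ⟨n, hn⟩ := hφ e h
  rcases n with _ | n
  -- Exponent zero gives `1 = 0`, and then every element vanishes.
  · have h1 : (1 : W) = 0 := by simpa using hn
    rw [← one_mul e, h1, zero_mul]
  · rwa [he.pow_succ_eq] at hn

end CInftyRingCat

/-! ### `C^∞`-rings of functions on a set of near-points -/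

section NearPoints

variable {k : ℕ} (S : ∀ W : CInftyRingCat, Set (Fin k → W))

/-- The functions which vanish at all points of `S` with coordinates in Weil algebras. -/
def nearPointIdeal : Ideal (SmoothFn k) where
  carrier := {f | ∀ W : CInftyRingCat, W.IsWeil → ∀ a ∈ S W, op f a = 0}
  add_mem' {f g} hf hg W hW a ha := by rw [op_add', hf W hW a ha, hg W hW a ha, add_zero]
  zero_mem' W _ a _ := op_zero' a
  smul_mem' f g hg W hW a ha := by rw [smul_eq_mul, op_mul', hg W hW a ha, mul_zero]

/-- The restrictions of smooth functions to a set of near-points. -/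
abbrev NearPointRing : Type := SmoothFn k ⧸ nearPointIdeal S

namespace NearPointRing

/-- Restriction of functions to a set of near-points. -/
abbrev mk (f : SmoothFn k) : NearPointRing S := Ideal.Quotient.mk (nearPointIdeal S) f

variable {S}

theorem mk_eq_mk {f g : SmoothFn k} :
    mk S f = mk S g ↔ ∀ W : CInftyRingCat, W.IsWeil → ∀ a ∈ S W, op f a = op g a := by
  rw [Ideal.Quotient.eq]
  refine forall₂_congr fun W _ => forall₂_congr fun a _ => ?_
  rw [op_sub', sub_eq_zero]

theorem mk_out (c : NearPointRing S) : mk S (Quotient.out c) = c := Quotient.out_eq c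

/-- Operations commute with evaluation at a near-point, so equality at all points of `S` is a
congruence for every operation at once. -/
theorem mk_op_congr {n : ℕ} (f : SmoothFn n) {a b : Fin n → SmoothFn k}
    (h : ∀ i, mk S (a i) = mk S (b i)) : mk S (op f a) = mk S (op f b) := by
  rw [mk_eq_mk]
  intro W hW x hx
  rw [SmoothFn.op_eq_comp, SmoothFn.op_eq_comp, CInftyRing.op_comp, CInftyRing.op_comp]
  exact congrArg (op f) (funext fun i => mk_eq_mk.1 (h i) W hW x hx)

variable (S) in
/-- The operation on restrictions induced by a smooth function. -/
def opAux {n : ℕ} (f : SmoothFn n) (c : Fin n → NearPointRing S) : NearPointRing S :=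
  mk S (op f fun i => Quotient.out (c i))

theorem opAux_mk {n : ℕ} (f : SmoothFn n) (a : Fin n → SmoothFn k) :
    opAux S f (fun i => mk S (a i)) = mk S (op f a) :=
  mk_op_congr f fun _ => mk_out _

instance : CInftyRing (NearPointRing S) where
  op := opAux S
  op_proj i c := mk_out _
  op_comp f g c := by
    refine Eq.trans ?_ (opAux_mk f fun i => op (g i) fun j => Quotient.out (c j)).symm
    rfl
  op_add c := by
    refine (congrArg (mk S) (CInftyRing.op_add _)).trans ?_
    exact (map_add (Ideal.Quotient.mk _) _ _).trans (congrArg₂ (· + ·) (mk_out _) (mk_out _))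
  op_mul c := by
    refine (congrArg (mk S) (CInftyRing.op_mul _)).trans ?_
    exact (map_mul (Ideal.Quotient.mk _) _ _).trans (congrArg₂ (· * ·) (mk_out _) (mk_out _))
  op_const r c := congrArg (mk S) (CInftyRing.op_const r _)

theorem op_mk {n : ℕ} (f : SmoothFn n) (a : Fin n → SmoothFn k) :
    op f (fun i => mk S (a i)) = mk S (op f a) := opAux_mk f a

variable (S) in
/-- The coordinate functions. -/
def X (i : Fin k) : NearPointRing S := mk S (SmoothFn.proj i)

theorem op_X (f : SmoothFn k) : op f (X S) = mk S f := op_mk f _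

theorem exists_op_X (c : NearPointRing S) : ∃ f : SmoothFn k, op f (X S) = c :=
  ⟨Quotient.out c, (op_X _).trans (mk_out c)⟩

variable (S) in
/-- The bundled `C^∞`-ring of functions on a set of near-points. -/
abbrev cat : CInftyRingCat := ⟨NearPointRing S⟩

/-- A family of elements of a `W`-determined `C^∞`-ring `B` all of whose
near-points belong to `S` determines a morphism to `B`. -/
def desc {B : CInftyRingCat} (hB : B.IsWDetermined) (b : Fin k → B)
    (hb : ∀ W : CInftyRingCat, W.IsWeil → ∀ χ : CInftyHom B W, (fun i => χ (b i)) ∈ S W) :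
    CInftyHom (NearPointRing S) B :=
  CInftyHom.lift exists_op_X b fun f f' h => hB _ _ fun W hW χ => by
    rw [op_X, op_X, mk_eq_mk] at h
    rw [χ.hom.map_op, χ.hom.map_op]
    exact h W hW _ (hb W hW χ.hom)

@[simp] theorem desc_X {B : CInftyRingCat} (hB : B.IsWDetermined) (b : Fin k → B)
    (hb : ∀ W : CInftyRingCat, W.IsWeil → ∀ χ : CInftyHom B W, (fun i => χ (b i)) ∈ S W) (i) :
    desc hB b hb (X S i) = b i := CInftyHom.lift_generator _ _ _ i

theorem isFinitelyGenerated : (cat S).IsFinitelyGenerated := ⟨k, X S, exists_op_X⟩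

/-- Evaluation at a near-point. -/
def eval {W : CInftyRingCat} (hW : W.IsWeil) {a : Fin k → W} (ha : a ∈ S W) :
    CInftyHom (NearPointRing S) W :=
  CInftyHom.lift exists_op_X a fun f f' h => by
    rw [op_X, op_X, mk_eq_mk] at h
    exact h W hW _ ha

theorem eval_mk {W : CInftyRingCat} (hW : W.IsWeil) {a : Fin k → W} (ha : a ∈ S W)
    (f : SmoothFn k) : eval hW ha (mk S f) = op f a := by
  rw [← op_X]; exact CInftyHom.lift_op _ _ _ f

/-- Evaluations at the points of `S` are morphisms to Weil algebras, and the ideal was defined so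
that they separate elements. -/
theorem isWDetermined : (cat S).IsWDetermined := by
  intro c d h
  change NearPointRing S at c d
  rw [← mk_out c, ← mk_out d, mk_eq_mk]
  intro W hW a ha
  have := h W hW ⟨eval hW ha⟩
  change eval hW ha c = eval hW ha d at this
  rwa [← mk_out c, ← mk_out d, eval_mk, eval_mk] at this

end NearPointRing

end NearPoints

/-! ### Coproducts -/

theorem isWDetermined_real : CInftyRingCat.IsWDetermined ⟨ℝ⟩ :=
  fun _ _ h => h ⟨ℝ⟩ CInftyRingCat.isWeil_real (𝟙 _)

section Coproduct

variable {A B : CInftyRingCat} {n m : ℕ} (g : Fin n → A) (h : Fin m → B)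

/-- The pairs of a near-point of `A` and a near-point of `B`, in terms of generators. -/
def pairPoints (W : CInftyRingCat) : Set (Fin (n + m) → W) :=
  {a | ∃ (φ : CInftyHom A W) (ψ : CInftyHom B W),
    a = Fin.append (fun i => φ (g i)) fun j => ψ (h j)}

/-- The coproduct of `A` and `B` among `W`-determined `C^∞`-rings. -/
abbrev Coprod : Type := NearPointRing (pairPoints g h)

/-- The bundled coproduct. -/
abbrev coprodCat : CInftyRingCat := NearPointRing.cat (pairPoints g h)

namespace Coprod

open NearPointRing

variable {g h} (hg : ∀ a : A, ∃ f : SmoothFn n, op f g = a)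
  (hh : ∀ b : B, ∃ f : SmoothFn m, op f h = b)

theorem inl_aux (f f' : SmoothFn n) (hf : op f g = op f' g) :
    op f (fun i => X (pairPoints g h) (Fin.castAdd m i)) =
      op f' (fun i => X (pairPoints g h) (Fin.castAdd m i)) := by
  rw [← op_rename (Fin.castAdd m) f, ← op_rename (Fin.castAdd m) f', op_X, op_X, mk_eq_mk]
  rintro W hW _ ⟨φ, ψ, rfl⟩
  simp only [op_rename, Fin.append_left]
  rw [← φ.map_op, ← φ.map_op, hf]

theorem inr_aux (f f' : SmoothFn m) (hf : op f h = op f' h) :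
    op f (fun i => X (pairPoints g h) (Fin.natAdd n i)) =
      op f' (fun i => X (pairPoints g h) (Fin.natAdd n i)) := by
  rw [← op_rename (Fin.natAdd n) f, ← op_rename (Fin.natAdd n) f', op_X, op_X, mk_eq_mk]
  rintro W hW _ ⟨φ, ψ, rfl⟩
  simp only [op_rename, Fin.append_right]
  rw [← ψ.map_op, ← ψ.map_op, hf]

variable (h) in
/-- The first coprojection. -/
def inl : CInftyHom A (Coprod g h) := CInftyHom.lift hg _ inl_aux

variable (g) in
/-- The second coprojection. -/
def inr : CInftyHom B (Coprod g h) := CInftyHom.lift hh _ inr_aux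

theorem inl_generator (i) : inl h hg (g i) = X (pairPoints g h) (Fin.castAdd m i) :=
  CInftyHom.lift_generator _ _ _ i

theorem inr_generator (i) : inr g hh (h i) = X (pairPoints g h) (Fin.natAdd n i) :=
  CInftyHom.lift_generator _ _ _ i

theorem append_mem_pairPoints {C : CInftyRingCat} (φ : CInftyHom A C) (ψ : CInftyHom B C)
    (W : CInftyRingCat) (_ : W.IsWeil) (χ : CInftyHom C W) :
    (fun i => χ ((Fin.append (fun i => φ (g i)) fun j => ψ (h j) : Fin (n + m) → C) i)) ∈
      pairPoints g h W :=
  ⟨χ.comp φ, χ.comp ψ, by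
    funext i
    refine Fin.addCases (fun j => ?_) (fun j => ?_) i <;> simp⟩

/-- The morphism from the coproduct with given components. -/
def desc {C : CInftyRingCat} (hC : C.IsWDetermined) (φ : CInftyHom A C) (ψ : CInftyHom B C) :
    CInftyHom (Coprod g h) C :=
  NearPointRing.desc hC (Fin.append (fun i => φ (g i)) fun j => ψ (h j))
    (append_mem_pairPoints φ ψ)

@[simp] theorem desc_inl {C : CInftyRingCat} (hC : C.IsWDetermined) (φ : CInftyHom A C)
    (ψ : CInftyHom B C) (a : A) : (desc hC φ ψ : CInftyHom (Coprod g h) C) (inl h hg a) = φ a := by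
  refine DFunLike.congr_fun (CInftyHom.ext_of_generators hg
    (φ := (desc hC φ ψ : CInftyHom (Coprod g h) C).comp (inl h hg)) fun i => ?_) a
  rw [CInftyHom.comp_apply, inl_generator, desc, NearPointRing.desc_X, Fin.append_left]

@[simp] theorem desc_inr {C : CInftyRingCat} (hC : C.IsWDetermined) (φ : CInftyHom A C)
    (ψ : CInftyHom B C) (b : B) : (desc hC φ ψ : CInftyHom (Coprod g h) C) (inr g hh b) = ψ b := by
  refine DFunLike.congr_fun (CInftyHom.ext_of_generators hh
    (φ := (desc hC φ ψ : CInftyHom (Coprod g h) C).comp (inr g hh)) fun i => ?_) b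
  rw [CInftyHom.comp_apply, inr_generator, desc, NearPointRing.desc_X, Fin.append_right]

theorem hom_ext {C : Type*} [CommRing C] [Algebra ℝ C] [CInftyRing C]
    {φ ψ : CInftyHom (Coprod g h) C} (h₁ : φ.comp (inl h hg) = ψ.comp (inl h hg))
    (h₂ : φ.comp (inr g hh) = ψ.comp (inr g hh)) : φ = ψ := by
  refine CInftyHom.ext_of_generators exists_op_X fun i => ?_
  refine Fin.addCases (fun j => ?_) (fun j => ?_) i
  · rw [← inl_generator hg]; exact DFunLike.congr_fun h₁ _
  · rw [← inr_generator hh]; exact DFunLike.congr_fun h₂ _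

-- Real points of the coproduct are pairs of real points. Fixing one coordinate sends an idempotent
-- to an idempotent of a connected algebra, so its value does not depend on the other coordinate; it
-- is therefore constant on real points. An idempotent vanishing at all real points vanishes at all
-- near-points, hence is zero.
include hg hh in
theorem isConnected (hA : A.IsSiteAlgebra) (hB : B.IsSiteAlgebra) :
    (coprodCat g h).IsConnected := by
  obtain ⟨-, ⟨-, eA⟩, ⟨a₀⟩, dA⟩ := hA
  obtain ⟨-, ⟨-, eB⟩, ⟨b₀⟩, dB⟩ := hB
  let pt (a : CInftyHom A ℝ) (b : CInftyHom B ℝ) : CInftyHom (Coprod g h) ℝ :=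
    desc (C := ⟨ℝ⟩) isWDetermined_real a b
  have hpt (χ : CInftyHom (Coprod g h) ℝ) : χ = pt (χ.comp (inl h hg)) (χ.comp (inr g hh)) := by
    refine hom_ext hg hh (CInftyHom.hom_ext fun a => ?_) (CInftyHom.hom_ext fun b => ?_)
    · exact (desc_inl (C := ⟨ℝ⟩) hg isWDetermined_real _ _ a).symm
    · exact (desc_inr (C := ⟨ℝ⟩) hh isWDetermined_real _ _ b).symm
  refine ⟨(pt a₀ b₀).toAlgHom.toRingHom.domain_nontrivial, fun e he => ?_⟩
  change Coprod g h at e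
  have h1 (a a' b) : pt a b e = pt a' b e := by
    -- `s` evaluates the second variable at `b`; composing it with `a` gives the real point `(a,
    -- b)`.
    let s : CInftyHom (Coprod g h) A := desc dA CInftyHom.id ((constHom A).comp b)
    have hs (a : CInftyHom A ℝ) : pt a b e = a (s e) := by
      refine DFunLike.congr_fun (f := pt a b) (g := a.comp s) ?_ e
      rw [hpt (a.comp s)]
      congr 1
      · refine CInftyHom.hom_ext fun x => ?_
        exact congrArg a (desc_inl hg dA CInftyHom.id ((constHom A).comp b) x).symm
      · refine CInftyHom.hom_ext fun x => ?_
        exact (a.toAlgHom.commutes (b x)).symm.trans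
          (congrArg a (desc_inr hh dA CInftyHom.id ((constHom A).comp b) x).symm)
    rw [hs, hs]
    rcases eA (s e) (he.map s) with h | h <;> simp [h]
  have h2 (a b b') : pt a b e = pt a b' e := by
    let s : CInftyHom (Coprod g h) B := desc dB ((constHom B).comp a) CInftyHom.id
    have hs (b : CInftyHom B ℝ) : pt a b e = b (s e) := by
      refine DFunLike.congr_fun (f := pt a b) (g := b.comp s) ?_ e
      rw [hpt (b.comp s)]
      congr 1
      · refine CInftyHom.hom_ext fun x => ?_
        exact (b.toAlgHom.commutes (a x)).symm.trans
          (congrArg b (desc_inl hg dB ((constHom B).comp a) CInftyHom.id x).symm)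
      · refine CInftyHom.hom_ext fun x => ?_
        exact congrArg b (desc_inr hh dB ((constHom B).comp a) CInftyHom.id x).symm
    rw [hs, hs]
    rcases eB (s e) (he.map s) with h | h <;> simp [h]
  have h3 (χ : CInftyHom (Coprod g h) ℝ) : χ e = pt a₀ b₀ e := by
    rw [hpt χ, h1 _ a₀, h2 _ _ b₀]
  -- Passage from real points to near-points; it is applied below to `e` or to `1 - e`, according to
  -- the constant value of `e`.
  have key (e' : Coprod g h) (he' : IsIdempotentElem e')
      (h0 : ∀ χ : CInftyHom (Coprod g h) ℝ, χ e' = 0) : e' = 0 := by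
    refine isWDetermined (S := pairPoints g h) e' 0 fun W hW χ => ?_
    obtain ⟨φ, hφ⟩ := hW.exists_hom
    rw [map_zero]
    exact CInftyRingCat.IsWeil.eq_zero_of_idempotent hφ (he'.map χ.hom) (h0 (φ.comp χ.hom))
  have h01 : pt a₀ b₀ e = 0 ∨ pt a₀ b₀ e = 1 := by
    have := he.map (pt a₀ b₀)
    rcases eq_or_ne (pt a₀ b₀ e) 0 with h | h
    · exact Or.inl h
    · exact Or.inr (mul_left_cancel₀ h (by rw [this.eq, mul_one]))
  rcases h01 with h | h
  · exact Or.inl (key e he fun χ => (h3 χ).trans h)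
  · refine Or.inr (sub_eq_zero.1 (key (1 - e) he.one_sub fun χ => ?_)).symm
    rw [map_sub, map_one, h3, h, sub_self]

include hg hh in
theorem isSiteAlgebra (hA : A.IsSiteAlgebra) (hB : B.IsSiteAlgebra) :
    (coprodCat g h).IsSiteAlgebra :=
  ⟨isFinitelyGenerated, isConnected hg hh hA hB,
    ⟨desc (C := ⟨ℝ⟩) isWDetermined_real hA.2.2.1.some hB.2.2.1.some⟩, isWDetermined⟩

end Coprod

end Coproduct

theorem isSiteAlgebra_real : CInftyRingCat.IsSiteAlgebra ⟨ℝ⟩ :=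
  ⟨⟨0, Fin.elim0, fun r => ⟨SmoothFn.const r, rfl⟩⟩, ⟨inferInstanceAs (Nontrivial ℝ), fun e he => by
    change ℝ at e
    rcases eq_or_ne e 0 with h | h
    · exact Or.inl h
    · exact Or.inr (mul_left_cancel₀ h (by rw [he.eq, mul_one]))⟩,
    ⟨CInftyHom.id⟩, isWDetermined_real⟩


/-! ### Dual numbers over a `C^∞`-ring -/

namespace SmoothFn

variable {n : ℕ}

/-- The differential `(x, v) ↦ (df)ₓ(v)`. -/
def tangent (f : SmoothFn n) : SmoothFn (n + n) :=
  ⟨fun z => fderiv ℝ f (fun i => z (Fin.castAdd n i)) fun i => z (Fin.natAdd n i),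
    ((f.2.fderiv_right (m := ∞) (by simp)).comp
      (contDiff_pi.2 fun i => contDiff_apply ℝ ℝ (Fin.castAdd n i))).clm_apply
      (contDiff_pi.2 fun i => contDiff_apply ℝ ℝ (Fin.natAdd n i))⟩

theorem tangent_apply (f : SmoothFn n) (z : Fin (n + n) → ℝ) : f.tangent z =
    fderiv ℝ f (fun i => z (Fin.castAdd n i)) fun i => z (Fin.natAdd n i) := rfl

/-- The chain rule, in the form needed for the operations of `A[ε]` to respect composition. -/
theorem tangent_comp {m : ℕ} (f : SmoothFn m) (g : Fin m → SmoothFn n) :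
    (f.comp g).tangent = f.tangent.comp
      (Fin.append (fun i => (g i).rename (Fin.castAdd n)) fun i => (g i).tangent) := by
  ext z
  have h : HasFDerivAt (f.comp g)
      ((fderiv ℝ f fun i => g i fun i => z (Fin.castAdd n i)).comp
        (ContinuousLinearMap.pi fun i => fderiv ℝ (g i) fun i => z (Fin.castAdd n i)))
      fun i => z (Fin.castAdd n i) :=
    (f.hasFDerivAt _).comp _ (hasFDerivAt_pi.2 fun i => (g i).hasFDerivAt _)
  rw [tangent_apply, h.fderiv, comp_apply, tangent_apply]
  simp only [Fin.append_left, Fin.append_right]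
  rfl

theorem tangent_proj (i : Fin n) : (proj i).tangent = proj (Fin.natAdd n i) := by
  ext z
  have h : HasFDerivAt (SmoothFn.proj i : SmoothFn n)
      (ContinuousLinearMap.proj (R := ℝ) (φ := fun _ : Fin n => ℝ) i)
      fun i => z (Fin.castAdd n i) :=
    (ContinuousLinearMap.proj (R := ℝ) (φ := fun _ : Fin n => ℝ) i).hasFDerivAt
  rw [tangent_apply, h.fderiv]
  rfl

theorem tangent_add : add.tangent = proj (Fin.natAdd 2 0) + proj (Fin.natAdd 2 1) := by
  ext z
  have h : HasFDerivAt SmoothFn.add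
      (ContinuousLinearMap.proj (R := ℝ) (φ := fun _ : Fin 2 => ℝ) 0 +
        ContinuousLinearMap.proj (R := ℝ) (φ := fun _ : Fin 2 => ℝ) 1)
      fun i => z (Fin.castAdd 2 i) :=
    (hasFDerivAt_apply 0 _).add (hasFDerivAt_apply 1 _)
  rw [tangent_apply, h.fderiv]
  rfl

theorem tangent_mul : mul.tangent = proj (Fin.castAdd 2 0) * proj (Fin.natAdd 2 1) +
    proj (Fin.castAdd 2 1) * proj (Fin.natAdd 2 0) := by
  ext z
  have h : HasFDerivAt SmoothFn.mul _ fun i => z (Fin.castAdd 2 i) :=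
    (hasFDerivAt_apply (𝕜 := ℝ) (F' := fun _ : Fin 2 => ℝ) 0 _).mul
      (hasFDerivAt_apply (𝕜 := ℝ) (F' := fun _ : Fin 2 => ℝ) 1 _)
  rw [tangent_apply, h.fderiv]
  rfl

theorem tangent_const (r : ℝ) : (const r : SmoothFn n).tangent = 0 := by
  ext z
  have h : HasFDerivAt (const r : SmoothFn n) 0 fun i => z (Fin.castAdd n i) :=
    hasFDerivAt_const (𝕜 := ℝ) (F := ℝ) r _
  rw [tangent_apply, h.fderiv]
  rfl

end SmoothFn

section Dual

variable (A : Type u) [CommRing A] [Algebra ℝ A] [CInftyRing A]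

/-- The `C^∞`-ring structure of `A[ε]`. -/
@[reducible]
def dualCInftyRing : CInftyRing (DualNumber A) where
  op f a := TrivSqZeroExt.inl (op f fun i => (a i).fst) +
    TrivSqZeroExt.inr (op f.tangent (Fin.append (fun i => (a i).fst) fun i => (a i).snd))
  op_proj i a := by
    rw [SmoothFn.tangent_proj, CInftyRing.op_proj, CInftyRing.op_proj, Fin.append_right]
    exact TrivSqZeroExt.inl_fst_add_inr_snd_eq _
  op_comp {m n} f g a := by
    rw [SmoothFn.tangent_comp, CInftyRing.op_comp, CInftyRing.op_comp]
    have h : (fun i : Fin (m + m) => op (Fin.append (fun i => (g i).rename (Fin.castAdd n))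
        (fun i => (g i).tangent) i) (Fin.append (fun i => (a i).fst) fun i => (a i).snd)) =
        Fin.append (fun i => op (g i) fun i => (a i).fst) fun i =>
          op (g i).tangent (Fin.append (fun i => (a i).fst) fun i => (a i).snd) := by
      funext i
      refine Fin.addCases (fun j => ?_) (fun j => ?_) i
      · simp only [Fin.append_left, op_rename]
      · simp only [Fin.append_right]
    rw [h]
    simp
  op_add a := by
    rw [SmoothFn.tangent_add, op_add', CInftyRing.op_add, CInftyRing.op_proj, CInftyRing.op_proj,
      Fin.append_right, Fin.append_right]
    ext <;> simp
  op_mul a := by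
    rw [SmoothFn.tangent_mul, op_add', op_mul', op_mul', CInftyRing.op_mul]
    simp only [CInftyRing.op_proj, Fin.append_right, Fin.append_left]
    ext <;> simp [mul_comm]
  op_const r a := by
    rw [SmoothFn.tangent_const, op_zero', CInftyRing.op_const]
    rw [TrivSqZeroExt.inr_zero, add_zero]
    rfl

end Dual

namespace CInftyRingCat

/-- The `C^∞`-ring `A[ε]`. -/
def dual (A : CInftyRingCat) : CInftyRingCat :=
  letI := dualCInftyRing A
  ⟨DualNumber A⟩

/-- The inclusion of `A` in `A[ε]`. -/
def dualInl (A : CInftyRingCat) : CInftyHom A A.dual :=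
  letI := dualCInftyRing A
  ({ toFun := TrivSqZeroExt.inl
     map_op' := fun {n} f a => by
      have h : op f.tangent (Fin.append a fun _ => (0 : A)) = 0 := by
        -- The differential vanishes on the zero vector; stated between smooth functions, the
        -- identity can be evaluated in any `A`.
        have h0 : f.tangent.comp (Fin.append SmoothFn.proj fun _ => (0 : SmoothFn n)) = 0 := by
          ext x
          rw [SmoothFn.comp_apply, SmoothFn.tangent_apply]
          simp only [Fin.append_right]
          exact map_zero _
        have h1 := congrArg (fun f => op f a) h0
        simp only [CInftyRing.op_comp, op_zero'] at h1
        refine (congrArg (op f.tangent) (funext fun i => ?_)).trans h1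
        refine Fin.addCases (fun j => ?_) (fun j => ?_) i
        · simp only [Fin.append_left, CInftyRing.op_proj]
        · simp only [Fin.append_right, op_zero']
      change _ = TrivSqZeroExt.inl (op f a) + TrivSqZeroExt.inr (op f.tangent (Fin.append a fun _ => 0))
      rw [h]
      simp } : CInftyHom A (DualNumber A))

/-- `W[ε]` is `W × W` as a vector space, and an element of it is nilpotent as soon as its constant
part is. -/
theorem IsWeil.dual {W : CInftyRingCat} (hW : W.IsWeil) : W.dual.IsWeil := by
  obtain ⟨hf, φ, hφ⟩ := hW
  refine ⟨inferInstanceAs (Module.Finite ℝ (W × W)),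
    φ.comp (TrivSqZeroExt.fstHom ℝ W W : DualNumber W →ₐ[ℝ] W), fun a ha => ?_⟩
  obtain ⟨k, hk⟩ := hφ _ ha
  exact TrivSqZeroExt.isNilpotent_iff_isNilpotent_fst.2 ⟨k, hk⟩

end CInftyRingCat

/-! ### Elements of square zero -/

section SquareZero

variable {A : Type} [CommRing A] [Algebra ℝ A] [CInftyRing A]

theorem op_fin_zero (f : SmoothFn 0) (a : Fin 0 → A) : op f a = algebraMap ℝ A (f Fin.elim0) := by
  rw [← op_const' _ a]
  congr 1
  ext x
  exact congrArg f (Subsingleton.elim _ _)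

theorem dualNumber_eq (z : DualNumber ℝ) :
    z = algebraMap ℝ (DualNumber ℝ) z.fst + algebraMap ℝ _ z.snd * DualNumber.eps := by
  ext <;> simp [TrivSqZeroExt.algebraMap_eq_inl]

/-- The morphism `ℝ[ε] → A` which sends `ε` to an element of square zero. -/
def squareZeroHom (d : A) (hd : d * d = 0) : CInftyHom (DualNumber ℝ) A where
  toFun z := algebraMap ℝ A z.fst + algebraMap ℝ A z.snd * d
  map_op' {n} f z := by
    -- The affine function `l i` takes the value `z i` at `ε`. The expansion coefficients of `f ∘ l`
    -- are real numbers, the same for `ε` in `ℝ[ε]` as for `d` in `A`, so the two evaluations can be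
    -- compared.
    let l (i : Fin n) : SmoothFn (0 + 1) :=
      SmoothFn.const (z i).fst + SmoothFn.const (z i).snd * SmoothFn.proj 0
    obtain ⟨f₀, f₁, h⟩ := (f.comp l).exists_op_append_eq
    have h₁ := h (A := DualNumber ℝ) Fin.elim0 DualNumber.eps DualNumber.eps_mul_eps
    have h₂ := h (A := A) Fin.elim0 d hd
    have hl {B : Type} [CommRing B] [Algebra ℝ B] [CInftyRing B] (e : B) (i) :
        op (l i) (Fin.append Fin.elim0 fun _ => e) =
          algebraMap ℝ B (z i).fst + algebraMap ℝ B (z i).snd * e := by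
      simp only [l, op_add', op_mul', op_const', CInftyRing.op_proj]
      rfl
    rw [CInftyRing.op_comp, op_fin_zero, op_fin_zero] at h₁ h₂
    simp only [hl, ← dualNumber_eq] at h₁ h₂
    rw [h₂, h₁]
    simp [TrivSqZeroExt.algebraMap_eq_inl, mul_comm]

@[simp] theorem squareZeroHom_eps (d : A) (hd : d * d = 0) :
    squareZeroHom d hd DualNumber.eps = d := by
  change algebraMap ℝ A (DualNumber.eps : DualNumber ℝ).fst +
    algebraMap ℝ A (DualNumber.eps : DualNumber ℝ).snd * d = d
  simp

theorem squareZero_hom_ext {φ ψ : CInftyHom (DualNumber ℝ) A}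
    (h : φ DualNumber.eps = ψ DualNumber.eps) : φ = ψ := by
  refine CInftyHom.hom_ext fun z => ?_
  rw [dualNumber_eq z]
  simp only [map_add, map_mul, h, AlgHomClass.commutes]

theorem map_eps_mul_self (φ : CInftyHom (DualNumber ℝ) A) :
    φ DualNumber.eps * φ DualNumber.eps = 0 := by
  rw [← map_mul, DualNumber.eps_mul_eps, map_zero]

end SquareZero

theorem exists_op_eps (z : DualNumber ℝ) :
    ∃ f : SmoothFn 1, op f (fun _ => (DualNumber.eps : DualNumber ℝ)) = z := by
  refine ⟨SmoothFn.const z.fst + SmoothFn.const z.snd * SmoothFn.proj 0, ?_⟩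
  simp only [op_add', op_mul', op_const', CInftyRing.op_proj]
  exact (dualNumber_eq z).symm

/-! ### Adjoining a universal element of square zero -/

section Extend

variable {A : CInftyRingCat} {n : ℕ} {g : Fin n → A} (hg : ∀ a : A, ∃ f : SmoothFn n, op f g = a)

/-- The bundled `C^∞`-ring of dual numbers. -/
abbrev dualReal : CInftyRingCat := ⟨DualNumber ℝ⟩

variable (g) in
/-- The coproduct of `A` and `ℝ[ε]`. -/
abbrev Extend : Type := Coprod (A := A) (B := dualReal) g fun _ : Fin 1 => DualNumber.eps

variable (g) in
/-- The universal element of square zero. -/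
def Extend.eps : Extend g :=
  (Coprod.inr (B := dualReal) g exists_op_eps : CInftyHom (DualNumber ℝ) _) DualNumber.eps

theorem Extend.eps_mul_eps : Extend.eps g * Extend.eps g = 0 := map_eps_mul_self _

/-- An element is a smooth function of the generators and `ε`, and such a function is affine in `ε`
because `ε² = 0`. -/
theorem Extend.exists_eq (c : Extend g) :
    ∃ a b : A, c = Coprod.inl _ hg a + Coprod.inl _ hg b * Extend.eps g := by
  obtain ⟨f, rfl⟩ := NearPointRing.exists_op_X c
  obtain ⟨f₀, f₁, h⟩ := f.exists_op_append_eq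
  refine ⟨op f₀ g, op f₁ g, ?_⟩
  rw [CInftyHom.map_op, CInftyHom.map_op, mul_comm, ← h _ _ Extend.eps_mul_eps]
  refine congrArg (op f) (funext fun i => ?_)
  refine Fin.addCases (fun j => ?_) (fun j => ?_) i
  · rw [Fin.append_left, Coprod.inl_generator]
  · rw [Fin.append_right]
    exact (Coprod.inr_generator (B := dualReal) exists_op_eps j).symm

/-- A near-point `φ : A → W` extends to a near-point with values in `W[ε]` sending the universal
element to `ε`. There the relation reads `φ a + φ b ε = 0`, so `a` and `b` vanish at all near-points
of `A`. -/
theorem Extend.eq_zero_of_add_mul_eps (hA : A.IsWDetermined) {a b : A}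
    (h : Coprod.inl _ hg a + Coprod.inl _ hg b * Extend.eps g = 0) : a = 0 ∧ b = 0 := by
  have key (W : CInftyRingCat) (hW : W.IsWeil) (φ : A ⟶ W) : φ.hom a = 0 ∧ φ.hom b = 0 := by
    have he : (DualNumber.eps : DualNumber W) * DualNumber.eps = 0 := DualNumber.eps_mul_eps
    let χ : CInftyHom (Extend g) W.dual :=
      NearPointRing.eval hW.dual ⟨W.dualInl.comp φ.hom,
        squareZeroHom (A := W.dual) DualNumber.eps he, rfl⟩
    have hl : χ.comp (Coprod.inl _ hg) = W.dualInl.comp φ.hom := by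
      refine CInftyHom.ext_of_generators hg fun i => ?_
      rw [CInftyHom.comp_apply, Coprod.inl_generator]
      refine (CInftyHom.lift_generator _ _ _ _).trans ?_
      rw [Fin.append_left]
    have hr : χ (Extend.eps g) = (DualNumber.eps : DualNumber W) := by
      have : Extend.eps g = NearPointRing.X _ (Fin.natAdd n 0) :=
        Coprod.inr_generator (B := dualReal) exists_op_eps 0
      rw [this]
      refine (CInftyHom.lift_generator _ _ _ _).trans ?_
      rw [Fin.append_right]
      exact squareZeroHom_eps (A := W.dual) _ he
    have h' := congrArg χ h
    rw [map_add, map_mul, map_zero, hr, ← CInftyHom.comp_apply, ← CInftyHom.comp_apply, hl] at h'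
    have h'' : (TrivSqZeroExt.inl (φ.hom a) + TrivSqZeroExt.inl (φ.hom b) * DualNumber.eps :
      DualNumber W) = 0 := h'
    constructor
    · simpa using congrArg TrivSqZeroExt.fst h''
    · simpa using congrArg TrivSqZeroExt.snd h''
  exact ⟨hA _ _ fun W hW φ => by rw [(key W hW φ).1, map_zero],
    hA _ _ fun W hW φ => by rw [(key W hW φ).2, map_zero]⟩

end Extend

/-! ### Invertible elements -/

section Units

variable {A : Type} [CommRing A] [Algebra ℝ A] [CInftyRing A]

/-- The exponential function. -/
def expFn : SmoothFn 1 := ⟨fun x => Real.exp (x 0), Real.contDiff_exp.comp (contDiff_apply ℝ ℝ 0)⟩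

/-- The exponential function of a `C^∞`-ring. -/
def cexp (a : A) : A := op expFn fun _ => a

theorem map_cexp {B : Type} [CommRing B] [Algebra ℝ B] [CInftyRing B] (φ : CInftyHom A B) (a : A) :
    φ (cexp a) = cexp (φ a) := φ.map_op _ _

theorem cexp_real (x : ℝ) : cexp x = Real.exp x := rfl

theorem cexp_add (a b : A) : cexp (a + b) = cexp a * cexp b := by
  have h := congrArg (fun f => op f ![a, b])
    (show expFn.comp (fun _ => SmoothFn.proj 0 + SmoothFn.proj (1 : Fin 2)) =
      expFn.comp (fun _ => SmoothFn.proj 0) * expFn.comp (fun _ => SmoothFn.proj 1) from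
      SmoothFn.ext fun x => Real.exp_add (x 0) (x 1))
  simpa [op_mul', op_add', CInftyRing.op_comp, CInftyRing.op_proj, cexp] using h

theorem cexp_zero : cexp (0 : A) = 1 := by
  rw [← map_zero (constHom A), ← map_cexp, cexp_real, Real.exp_zero, map_one]

theorem cexp_mul_cexp_neg (a : A) : cexp a * cexp (-a) = 1 := by
  rw [← cexp_add, add_neg_cancel, cexp_zero]

/-- A smooth function on the plane which is equal to `log |x|` near the hyperbola `x y = 1`. -/
theorem exists_log : ∃ l : SmoothFn 2, ∀ {A : Type} [CommRing A] [Algebra ℝ A] [CInftyRing A]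
    (u v : A), u * v = 1 → cexp (op l ![u, v]) * cexp (op l ![u, v]) = u * u := by
  -- The second summand vanishes where `x y ≥ 1/2`, a neighbourhood of the hyperbola, and is
  -- positive on the line `x = 0`. So `q` is positive everywhere and equals `x²` near the hyperbola,
  -- and `½ log q` is smooth on the whole plane.
  let q (x : Fin 2 → ℝ) : ℝ := x 0 * x 0 + Real.smoothTransition (1 / 2 - x 0 * x 1)
  have hq : ContDiff ℝ ∞ q := by
    refine ContDiff.add (by fun_prop) (Real.smoothTransition.contDiff.comp (by fun_prop))
  have hpos (x) : 0 < q x := by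
    rcases eq_or_ne (x 0) 0 with h | h
    · have : 0 < Real.smoothTransition (1 / 2 - x 0 * x 1) :=
        Real.smoothTransition.pos_of_pos (by rw [h]; norm_num)
      simpa [q, h] using this
    · exact add_pos_of_pos_of_nonneg (mul_self_pos.2 h) (Real.smoothTransition.nonneg _)
  let l : SmoothFn 2 := ⟨fun x => 1 / 2 * Real.log (q x),
    contDiff_const.mul (hq.log fun x => (hpos x).ne')⟩
  have hl (x) : Real.exp (l x) * Real.exp (l x) = q x := by
    rw [← Real.exp_add]
    change Real.exp (1 / 2 * Real.log (q x) + 1 / 2 * Real.log (q x)) = _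
    rw [← add_mul]
    norm_num [Real.exp_log (hpos x)]
  let p : SmoothFn 2 := SmoothFn.proj 0 * SmoothFn.proj 1 - 1
  let F : SmoothFn 2 := expFn.comp (fun _ => l) * expFn.comp (fun _ => l) -
    SmoothFn.proj 0 * SmoothFn.proj 0
  have hF (x) : F x = Real.smoothTransition (1 / 2 - x 0 * x 1) := by
    change Real.exp (l x) * Real.exp (l x) - x 0 * x 0 = _
    rw [hl]
    simp [q]
  have hev (x) (hx : p x = 0) : ∀ᶠ y in nhds x, F y = 0 := by
    have hx : x 0 * x 1 - 1 = 0 := hx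
    have hc : ContinuousAt (fun y : Fin 2 → ℝ => y 0 * y 1) x := by fun_prop
    filter_upwards [hc.eventually (lt_mem_nhds (show 1 / 2 < x 0 * x 1 by linarith))] with y hy
    rw [hF, Real.smoothTransition.zero_of_nonpos (by linarith)]
  -- Divisibility of `F` by `x y - 1` transfers the identity to any `C^∞`-ring: the factor `p`
  -- becomes zero at `(u, v)`.
  let k : SmoothFn 2 := ⟨fun x => F x / p x, contDiff_div_of_eventually F.2 p.2 hev⟩
  have hFp : F = p * k := by
    ext x
    change F x = p x * (F x / p x)
    rcases eq_or_ne (p x) 0 with h | h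
    · rw [h, zero_mul, (hev x h).self_of_nhds]
    · rw [mul_div_cancel₀ _ h]
  refine ⟨l, fun {A} _ _ _ u v huv => ?_⟩
  have hp : op p ![u, v] = 0 := by simp [p, op_sub', op_mul', CInftyRing.op_proj, op_one', huv]
  have h0 : op F ![u, v] = 0 := by rw [hFp, op_mul', hp, zero_mul]
  simpa [F, op_sub', op_mul', CInftyRing.op_comp, CInftyRing.op_proj, sub_eq_zero, cexp] using h0

/-- The invertible elements of a connected `C^∞`-ring are the `± exp a`. -/
theorem exists_eq_cexp (hA : ∀ e : A, IsIdempotentElem e → e = 0 ∨ e = 1) {u v : A}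
    (h : u * v = 1) : ∃ a : A, u = cexp a ∨ u = -cexp a := by
  obtain ⟨l, hl⟩ := exists_log
  refine ⟨op l ![u, v], ?_⟩
  have h1 := hl u v h
  generalize op l ![u, v] = a at h1
  have h2 := cexp_mul_cexp_neg a
  -- `w` plays the role of the sign of `u`: once `w² = 1`, the element `(1 + w) / 2` is idempotent,
  -- and connectedness leaves `w = 1` or `w = -1`.
  let w := u * cexp (-a)
  have hw : w * w = 1 := by
    calc w * w = (u * u) * (cexp (-a) * cexp (-a)) := by ring
      _ = (cexp a * cexp (-a)) * (cexp a * cexp (-a)) := by rw [← h1]; ring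
      _ = 1 := by rw [h2, one_mul]
  have hu : u = w * cexp a := by
    calc u = u * (cexp a * cexp (-a)) := by rw [h2, mul_one]
      _ = w * cexp a := by ring
  have h12 : algebraMap ℝ A (1 / 2) + algebraMap ℝ A (1 / 2) = 1 := by
    rw [← map_add, add_halves, map_one]
  generalize algebraMap ℝ A (1 / 2) = t at h12
  have he : IsIdempotentElem (t * (1 + w)) := by
    change t * (1 + w) * (t * (1 + w)) = t * (1 + w)
    linear_combination (t * (1 + w)) * h12 + t * t * hw
  have hw' : w = t * (1 + w) + t * (1 + w) - 1 := by linear_combination (-(1 + w)) * h12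
  rcases hA _ he with h | h
  · right; rw [hu, hw', h]; ring
  · left; rw [hu, hw', h]; ring

end Units


/-! ### Limits and colimits over the site -/

/-- The category of algebras which is dual to the site. -/
abbrev SiteAlg : Type 1 := CInftyRingCat.IsSiteAlgebra.FullSubcategory

/-- The bijection between morphisms of the site algebras and morphisms of `C^∞`-rings. -/
abbrev SiteAlg.ofHom {A B : SiteAlg} (φ : CInftyHom A.obj B.obj) : A ⟶ B := ⟨⟨φ⟩⟩

theorem SiteAlg.hom_ext {A B : SiteAlg} {φ ψ : A ⟶ B} (h : ∀ x, φ.hom.hom x = ψ.hom.hom x) :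
    φ = ψ :=
  InducedCategory.hom_ext (CInftyRingCat.Hom.ext (CInftyHom.hom_ext h))

/-- The mediating morphism exists because its target is `W`-determined: a relation valid at all
pairs of near-points holds there too. -/
instance : HasBinaryCoproducts SiteAlg := by
  suffices ∀ {A B : SiteAlg}, HasColimit (pair A B) from hasBinaryCoproducts_of_hasColimit_pair _
  intro A B
  obtain ⟨A, hA⟩ := A
  obtain ⟨B, hB⟩ := B
  obtain ⟨n, g, hg⟩ := hA.1
  obtain ⟨m, h, hh⟩ := hB.1
  let P : SiteAlg := ⟨coprodCat g h, Coprod.isSiteAlgebra hg hh hA hB⟩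
  let l : (⟨A, hA⟩ : SiteAlg) ⟶ P := SiteAlg.ofHom (Coprod.inl h hg)
  let r : (⟨B, hB⟩ : SiteAlg) ⟶ P := SiteAlg.ofHom (Coprod.inr g hh)
  refine ⟨⟨BinaryCofan.mk l r, BinaryCofan.isColimitMk
    (fun s => SiteAlg.ofHom (Coprod.desc s.pt.property.2.2.2 s.inl.hom.hom s.inr.hom.hom))
    (fun s => ?_) (fun s => ?_) (fun s m h₁ h₂ => ?_)⟩⟩
  · exact SiteAlg.hom_ext fun x => Coprod.desc_inl hg s.pt.property.2.2.2 _ s.inr.hom.hom x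
  · exact SiteAlg.hom_ext fun x => Coprod.desc_inr hh s.pt.property.2.2.2 s.inl.hom.hom _ x
  · refine SiteAlg.hom_ext (DFunLike.congr_fun (Coprod.hom_ext hg hh
      (CInftyHom.hom_ext fun x => ?_) (CInftyHom.hom_ext fun x => ?_)))
    · exact (congrArg (fun k => k.hom.hom x) h₁).trans
        (Coprod.desc_inl hg s.pt.property.2.2.2 _ s.inr.hom.hom x).symm
    · exact (congrArg (fun k => k.hom.hom x) h₂).trans
        (Coprod.desc_inr hh s.pt.property.2.2.2 s.inl.hom.hom _ x).symm

/-- The algebra `ℝ`, as an object of the indexing category of presheaves. -/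
def realObj : Siteᵒᵖ := Opposite.op (Site.spec ⟨ℝ⟩ isSiteAlgebra_real)

/-- Morphisms of the indexing category of presheaves, from morphisms of `C^∞`-rings. -/
abbrev Site.ofHom {X Y : Siteᵒᵖ} (φ : CInftyHom X.unop.algebra Y.unop.algebra) : X ⟶ Y :=
  Quiver.Hom.op (Quiver.Hom.op (SiteAlg.ofHom φ))

theorem Site.hom_ext {X Y : Siteᵒᵖ} {φ ψ : X ⟶ Y}
    (h : ∀ x, φ.unop.unop.hom.hom x = ψ.unop.unop.hom.hom x) : φ = ψ :=
  Quiver.Hom.unop_inj (Quiver.Hom.unop_inj (SiteAlg.hom_ext h))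

theorem constHom_unique {A : Type*} [CommRing A] [Algebra ℝ A] [CInftyRing A]
    (φ : CInftyHom ℝ A) : φ = constHom A :=
  CInftyHom.hom_ext fun x => φ.toAlgHom.commutes x

/-- `ℝ` is the initial algebra. -/
def isInitialRealObj : IsInitial realObj :=
  IsInitial.ofUniqueHom (fun X => Site.ofHom (constHom X.unop.algebra)) fun X φ => by
    refine Site.hom_ext fun x => ?_
    exact DFunLike.congr_fun (constHom_unique φ.unop.unop.hom.hom) x

instance : IsSifted Siteᵒᵖ :=
  have : Nonempty Siteᵒᵖ := ⟨realObj⟩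
  IsSifted.isSifted_of_hasBinaryCoproducts_and_nonempty

/-- Colimits of sets over essentially small sifted categories commute with finite products. -/
theorem preservesFiniteProducts_colim (J : Type u) [Category.{v} J] [EssentiallySmall.{0} J]
    [IsSifted J] [HasColimitsOfShape J Type] :
    PreservesFiniteProducts (colim : (J ⥤ Type) ⥤ Type) := by
  -- Sifted colimits are known to commute with finite products for small index categories, so the
  -- colimit is computed over a small model.
  let e := equivSmallModel.{0} J
  have : IsSifted (SmallModel.{0} J) := IsSifted.isSifted_of_equiv e.symm
  have h : PreservesFiniteProducts (colim : (SmallModel.{0} J ⥤ Type) ⥤ Type) := inferInstance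
  exact ⟨fun n => preservesLimitsOfShape_of_natIso (Functor.Final.colimIso e.inverse)⟩

instance : PreservesFiniteProducts components := preservesFiniteProducts_colim _

/-! ### The canonical geometric morphism is pre-cohesive -/

/-- Global sections are given by the values at `ℝ`. -/
def pointsIso : points ≅ (evaluation Siteᵒᵖ Type).obj realObj :=
  NatIso.ofComponents (fun F =>
    haveI := isIso_π_of_isInitial isInitialRealObj F
    asIso (limit.π F realObj)) fun _ => limMap_π _ _

/-- Evaluation at an object has a right adjoint. This also gives preservation of coequalizers in
`isPreCohesive_pointsAdj`. -/
theorem isLeftAdjoint_points : points.IsLeftAdjoint :=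
  ((evaluationAdjunctionLeft Type realObj).ofNatIsoLeft pointsIso.symm).isLeftAdjoint

/-- A transpose in the presheaf topos is invertible if it is so on representables. -/
theorem isIso_curry {D P Q : Psh} (m : D ⊗ P ⟶ Q)
    (h : ∀ (X : Siteᵒᵖ) (g : D ⊗ yoneda.obj X.unop ⟶ Q), ∃! p : P.obj X,
      ∀ (Z : Siteᵒᵖ) (d : D.obj Z) (f : X ⟶ Z), m.app Z (d, P.map f p) = g.app Z (d, f.unop)) :
    IsIso (MonoidalClosed.curry m) := by
  rw [NatTrans.isIso_iff_isIso_app]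
  intro X
  rw [isIso_iff_bijective, Function.bijective_iff_existsUnique]
  intro b
  -- By Yoneda, an element `b` of `Q^D` at `X` is a map `D × X → Q`.
  let g : D ⊗ yoneda.obj X.unop ⟶ Q := MonoidalClosed.uncurry (yonedaEquiv.symm b)
  have key (p : P.obj X) : (MonoidalClosed.curry m).app X p = b ↔
      ∀ (Z : Siteᵒᵖ) (d : D.obj Z) (f : X ⟶ Z), m.app Z (d, P.map f p) = g.app Z (d, f.unop) := by
    have h1 : (MonoidalClosed.curry m).app X p = b ↔
        D ◁ yonedaEquiv.symm p ≫ m = g := by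
      rw [← MonoidalClosed.curry_injective.eq_iff, MonoidalClosed.curry_natural_left,
        MonoidalClosed.curry_uncurry, ← yonedaEquiv.apply_eq_iff_eq, yonedaEquiv_comp,
        Equiv.apply_symm_apply, Equiv.apply_symm_apply]
    rw [h1]
    constructor
    · intro e Z d f
      rw [← e]
      rfl
    · intro e
      ext Z ⟨d, f⟩
      exact e Z d f.op
  simp only [key]
  exact h X g

theorem isPreCohesive_pointsAdj : IsPreCohesive pointsAdj := by
  have hfull : discrete.Full := inferInstance
  have hfaithful : discrete.Faithful := inferInstance
  have := isLeftAdjoint_points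
  refine
    { full := hfull
      faithful := hfaithful
      mono_counit := fun X => ?_
      isIso_expComparisonMap := fun A X => ?_
      preservesCoequalizers := inferInstance }
  · have (Y : Siteᵒᵖ) : Mono ((pointsAdj.counit.app X).app Y) := by
      -- A copoint of the algebra gives a map to `F(ℝ)` after which the counit becomes the
      -- isomorphism from the limit to `F(ℝ)`.
      obtain ⟨ρ⟩ := Y.unop.unop.property.2.2.1
      let r : Y ⟶ realObj := Site.ofHom ρ
      have hr : (pointsAdj.counit.app X).app Y ≫ X.map r = limit.π X realObj :=
        limit.w X r
      have := isIso_π_of_isInitial isInitialRealObj X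
      have : Mono ((pointsAdj.counit.app X).app Y ≫ X.map r) := by rw [hr]; infer_instance
      exact mono_of_mono _ (X.map r)
    exact NatTrans.mono_of_mono_app _
  · have : inv (CartesianMonoidalCategory.prodComparison discrete A ((ihom A).obj X)) ≫
      discrete.map ((ihom.ev A).app X) =
        { app := fun _ => (ihom.ev A).app X } := by
      rw [IsIso.inv_comp_eq]
      rfl
    rw [expComparisonMap, this]
    -- Restriction in constant presheaves is the identity, so naturality gives `g (a, f) = g (a,
    -- 𝟙)`, and `g` is a function of `a` alone.
    refine isIso_curry _ fun Y g =>
      ⟨TypeCat.ofHom fun a => g.app Y (a, 𝟙 _), fun Z a f => ?_, fun p hp => ?_⟩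
    · have h := ConcreteCategory.congr_hom (C := Type) (g.naturality f)
        (Prod.mk a (𝟙 Y.unop) : A × (Y.unop ⟶ Y.unop))
      refine h.symm.trans (congrArg (fun k => g.app Z (a, k)) (Category.comp_id f.unop))
    · exact ConcreteCategory.hom_ext (C := Type) _ _ fun a => hp Y a (𝟙 Y)

/-- Representable presheaves are connected. -/
theorem isConnectedObj_yoneda (X : Site) : IsConnectedObj components (yoneda.obj X) :=
  ⟨HasColimit.isoOfNatIso (Coyoneda.objOpOp X).symm ≪≫ Coyoneda.colimitCoyonedaIso _ ≪≫
    Types.terminalIso.symm⟩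


/-! ### The Kock-Lawvere axiom -/

section KockLawvere

open MonObj
open scoped CommRingObj RingObj

theorem R.equiv_mul {P : Psh} (a b : P ⟶ R) (X : Siteᵒᵖ) (p : P.obj X) :
    R.equiv X ((a * b).app X p) = R.equiv X (a.app X p) * R.equiv X (b.app X p) :=
  (R.equiv X).apply_symm_apply _

theorem R.equiv_add {P : Psh} (a b : P ⟶ R) (X : Siteᵒᵖ) (p : P.obj X) :
    R.equiv X ((a + b).app X p) = R.equiv X (a.app X p) + R.equiv X (b.app X p) :=
  (R.equiv X).apply_symm_apply _

theorem R.equiv_zero {P : Psh} (X : Siteᵒᵖ) (p : P.obj X) :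
    R.equiv X ((0 : P ⟶ R).app X p) = 0 := (R.equiv X).apply_symm_apply _

theorem R.equiv_one {P : Psh} (X : Siteᵒᵖ) (p : P.obj X) :
    R.equiv X ((1 : P ⟶ R).app X p) = 1 := (R.equiv X).apply_symm_apply _

theorem R.hom_ext {P : Psh} {a b : P ⟶ R}
    (h : ∀ (X : Siteᵒᵖ) (p : P.obj X), R.equiv X (a.app X p) = R.equiv X (b.app X p)) : a = b := by
  ext X p
  exact (R.equiv X).injective (h X p)

theorem R.equiv_naturality {P : Psh} (a : P ⟶ R) {X Y : Siteᵒᵖ} (f : X ⟶ Y) (p : P.obj X) :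
    R.equiv Y (a.app Y (P.map f p)) = f.unop.unop.hom.hom (R.equiv X (a.app X p)) :=
  congrArg (R.equiv Y) (ConcreteCategory.congr_hom (C := Type) (a.naturality f) p)

/-- The map `j` identifies `D` with the elements of square zero of `R`. -/
structure IsSquareZeroIncl {D : Psh} (j : D ⟶ R) : Prop where
  injective : ∀ X, Function.Injective (j.app X)
  mul_self : ∀ X d, R.equiv X (j.app X d) * R.equiv X (j.app X d) = 0
  exists_eq : ∀ X (a : X.unop.algebra), a * a = 0 → ∃ d, R.equiv X (j.app X d) = a

theorem T.equiv_incl {X : Siteᵒᵖ} (t : T.obj X) : R.equiv X (T.incl.app X t) =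
    X.unop.homSpecEquiv _ CInftyRingCat.isSiteAlgebra_dual t DualNumber.eps := by
  change X.unop.homSpecEquiv _ CInftyRingCat.isSiteAlgebra_dual t
    ((smoothLine.homEquiv (DualNumber ℝ)).symm DualNumber.eps smoothLine.X) = _
  congr 1
  exact (smoothLine.homEquiv (DualNumber ℝ)).apply_symm_apply _

/-- Morphisms `ℝ[ε] → A` are the elements of square zero of `A`. Together with
`isSquareZeroIncl_squareZero` this lets `T` and `D` share one proof that functions on them are
affine. -/
theorem isSquareZeroIncl_T : IsSquareZeroIncl T.incl where
  injective X t t' h := by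
    apply (X.unop.homSpecEquiv _ _).injective
    refine squareZero_hom_ext ?_
    exact (T.equiv_incl t).symm.trans ((congrArg (R.equiv X) h).trans (T.equiv_incl t'))
  mul_self X t := by
    rw [T.equiv_incl]
    exact map_eps_mul_self _
  exists_eq X a ha := by
    refine ⟨(X.unop.homSpecEquiv _ CInftyRingCat.isSiteAlgebra_dual).symm (squareZeroHom a ha), ?_⟩
    refine (T.equiv_incl _).trans (Eq.trans
      (congrArg (fun φ : CInftyHom (DualNumber ℝ) X.unop.algebra => φ DualNumber.eps)
      (Equiv.apply_symm_apply _ _)) ?_)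
    exact squareZeroHom_eps a ha

theorem isSquareZeroIncl_squareZero : IsSquareZeroIncl (SquareZero.incl R) where
  injective X := by
    have : Mono (SquareZero.incl R) := inferInstanceAs (Mono (equalizer.ι _ _))
    exact (mono_iff_injective _).1 (inferInstanceAs (Mono ((SquareZero.incl R).app X)))
  mul_self X d := by
    have h : SquareZero.incl R ≫ (𝟙 R * 𝟙 R) = SquareZero.incl R ≫ 0 := equalizer.condition _ _
    have h1 := congrArg (fun k => R.equiv X (k.app X d)) h
    exact (R.equiv_mul (𝟙 R) (𝟙 R) X _).symm.trans (h1.trans (R.equiv_zero X _))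
  exists_eq X a ha := by
    let r : yoneda.obj X.unop ⟶ R := yonedaEquiv.symm ((R.equiv X).symm a)
    have hr : r ≫ (𝟙 R * 𝟙 R) = r ≫ 0 := by
      refine yonedaEquiv.injective ?_
      rw [yonedaEquiv_comp, yonedaEquiv_comp, Equiv.apply_symm_apply]
      apply (R.equiv X).injective
      refine (R.equiv_mul (𝟙 R) (𝟙 R) X _).trans (Eq.trans ?_ (R.equiv_zero X _).symm)
      change R.equiv X ((R.equiv X).symm a) * R.equiv X ((R.equiv X).symm a) = 0
      rw [Equiv.apply_symm_apply, ha]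
    let k : yoneda.obj X.unop ⟶ SquareZero R := equalizer.lift r hr
    have h : k ≫ SquareZero.incl R = r := equalizer.lift_ι _ _
    refine ⟨yonedaEquiv k, (R.equiv X).symm_apply_eq.1 ?_ |>.symm⟩
    rw [← yonedaEquiv_comp, h, Equiv.apply_symm_apply]

/-- The map `(d, (a, b)) ↦ a + b d`. -/
def affineMap {D : Psh} (j : D ⟶ R) : D ⊗ (R ⊗ R) ⟶ R :=
  snd _ _ ≫ fst R R + (snd _ _ ≫ snd R R) * (fst _ _ ≫ j)

theorem equiv_affineMap {D : Psh} (j : D ⟶ R) (X : Siteᵒᵖ) (d : D.obj X) (a b : R.obj X) :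
    R.equiv X ((affineMap j).app X (d, (a, b))) =
      R.equiv X a + R.equiv X b * R.equiv X (j.app X d) :=
  (R.equiv_add _ _ X _).trans (congrArg (R.equiv X a + ·) (R.equiv_mul _ _ X _))

/-- Functions on the elements of square zero are affine. -/
theorem isIso_curry_affineMap {D : Psh} {j : D ⟶ R} (hj : IsSquareZeroIncl j) :
    IsIso (MonoidalClosed.curry (affineMap j)) := by
  refine isIso_curry _ fun X g => ?_
  have hX := X.unop.unop.property
  obtain ⟨n, e, he⟩ := hX.1
  -- The generic case: over the coproduct of the algebra of `X` with `ℝ[ε]`, `d₀` is the universal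
  -- element of square zero. Any `(d, f)` over `Z` is the restriction of `(d₀, l)` along `q` below,
  -- so `g` is determined by the single element `c`.
  let Y : Siteᵒᵖ := Opposite.op (Site.spec (coprodCat e fun _ : Fin 1 => (DualNumber.eps : dualReal))
    (Coprod.isSiteAlgebra he exists_op_eps hX CInftyRingCat.isSiteAlgebra_dual))
  let l : X ⟶ Y := Site.ofHom (Coprod.inl _ he)
  obtain ⟨d₀, hd₀⟩ := hj.exists_eq Y ((Extend.eps e)) Extend.eps_mul_eps
  let c : Extend e := R.equiv Y (g.app Y (d₀, l.unop))
  obtain ⟨a, b, hc⟩ := Extend.exists_eq he c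
  refine ⟨((R.equiv X).symm a, (R.equiv X).symm b), fun Z d f => ?_, ?_⟩
  · apply (R.equiv Z).injective
    refine (equiv_affineMap j Z d (R.map f ((R.equiv X).symm a))
      (R.map f ((R.equiv X).symm b))).trans ?_
    rw [R.equiv_map, R.equiv_map, Equiv.apply_symm_apply, Equiv.apply_symm_apply]
    let δ := squareZeroHom _ (hj.mul_self Z d)
    let χ : CInftyHom (Extend e) Z.unop.algebra :=
      Coprod.desc (B := dualReal) Z.unop.unop.property.2.2.2 f.unop.unop.hom.hom δ
    have hχl (x) : χ (Coprod.inl _ he x) = f.unop.unop.hom.hom x :=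
      Coprod.desc_inl (B := dualReal) he Z.unop.unop.property.2.2.2 f.unop.unop.hom.hom δ x
    have hχr : χ (Extend.eps e) = R.equiv Z (j.app Z d) :=
      (Coprod.desc_inr (B := dualReal) exists_op_eps Z.unop.unop.property.2.2.2 f.unop.unop.hom.hom δ
        _).trans (squareZeroHom_eps _ _)
    let q : Y ⟶ Z := Site.ofHom χ
    have hq : l ≫ q = f := Site.hom_ext hχl
    have hd : D.map q d₀ = d := by
      apply hj.injective
      apply (R.equiv Z).injective
      rw [R.equiv_naturality, hd₀]
      exact hχr
    have hg : g.app Z (d, f.unop) = R.map q (g.app Y (d₀, l.unop)) := by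
      rw [← hq, ← hd]
      exact ConcreteCategory.congr_hom (C := Type) (g.naturality q)
        (Prod.mk d₀ l.unop : D.obj Y × (Y.unop ⟶ X.unop))
    rw [hg, R.equiv_map]
    change _ = χ c
    rw [hc, map_add, map_mul, hχl, hχl, hχr]
    rfl
  -- Uniqueness needs only the generic point, where the coefficients of `c` are unique.
  · rintro ⟨a', b'⟩ h
    have h1 := congrArg (R.equiv Y) (h Y d₀ l)
    have h2 := (equiv_affineMap j Y d₀ (R.map l a') (R.map l b')).symm.trans h1
    rw [R.equiv_map, R.equiv_map, hd₀] at h2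
    change Coprod.inl _ he (R.equiv X a') + Coprod.inl _ he (R.equiv X b') * Extend.eps e = c at h2
    have h3 := Extend.eq_zero_of_add_mul_eps he hX.2.2.2 (a := R.equiv X a' - a)
      (b := R.equiv X b' - b) (by rw [map_sub, map_sub]; linear_combination h2 + hc)
    refine Prod.ext ((R.equiv X).injective ?_) ((R.equiv X).injective ?_)
    · rw [Equiv.apply_symm_apply]; exact sub_eq_zero.1 h3.1
    · rw [Equiv.apply_symm_apply]; exact sub_eq_zero.1 h3.2

theorem kockLawvere_R : KockLawvere R := isIso_curry_affineMap isSquareZeroIncl_squareZero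

end KockLawvere


/-! ### Euler reals -/

section Euler

open MonObj
open scoped CommRingObj RingObj

theorem applyAt_curry {E : Type u} [Category.{v} E] [CartesianMonoidalCategory E] {T X P Z : E}
    [Closed T] (m : T ⊗ P ⟶ X) (k : Z ⟶ P) (t : Z ⟶ T) :
    applyAt (k ≫ MonoidalClosed.curry m) t = lift t k ≫ m := by
  have h : lift t (k ≫ MonoidalClosed.curry m) = lift t k ≫ T ◁ MonoidalClosed.curry m := by
    ext <;> simp
  rw [applyAt, h, Category.assoc, ← MonoidalClosed.uncurry_eq, MonoidalClosed.uncurry_curry]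

theorem applyAt_comp {E : Type u} [Category.{v} E] [CartesianMonoidalCategory E] {T X Y Z : E}
    [Closed T] (f : Z ⟶ (ihom T).obj X) (t : Z ⟶ T) (h : X ⟶ Y) :
    applyAt f t ≫ h = applyAt (f ≫ (ihom T).map h) t := by
  have h1 : lift t (f ≫ (ihom T).map h) = lift t f ≫ T ◁ (ihom T).map h := by ext <;> simp
  rw [applyAt, applyAt, h1, Category.assoc, Category.assoc]
  congr 1
  exact ((ihom.ev T).naturality h).symm

instance : Mono T.incl :=
  have (X : Siteᵒᵖ) : Mono (T.incl.app X) := (mono_iff_injective _).2 (isSquareZeroIncl_T.injective X)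
  NatTrans.mono_of_mono_app _

/-- A map to `R` with values of square zero factors through `T`. -/
theorem exists_comp_incl {Z : Psh} (h : Z ⟶ R) (hh : h * h = 0) : ∃ k : Z ⟶ T, k ≫ T.incl = h := by
  have (X : Siteᵒᵖ) (z : Z.obj X) : ∃ t, T.incl.app X t = h.app X z := by
    obtain ⟨t, ht⟩ := isSquareZeroIncl_T.exists_eq X (R.equiv X (h.app X z)) (by
      rw [← R.equiv_mul, hh, R.equiv_zero])
    exact ⟨t, (R.equiv X).injective ht⟩
  choose k hk using this
  refine ⟨{ app := fun X => TypeCat.ofHom (k X), naturality := fun X Y f => ?_ }, ?_⟩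
  · ext z
    apply isSquareZeroIncl_T.injective
    refine (hk Y (Z.map f z)).trans ?_
    refine (ConcreteCategory.congr_hom (C := Type) (h.naturality f) z).trans ?_
    refine (congrArg (R.map f) (hk X z).symm).trans ?_
    exact (ConcreteCategory.congr_hom (C := Type) (T.incl.naturality f) (k X z)).symm
  · ext X z
    exact hk X z

theorem incl_mul_incl : T.incl * T.incl = 0 :=
  R.hom_ext fun X t => (R.equiv_mul _ _ X t).trans
    ((isSquareZeroIncl_T.mul_self X t).trans (R.equiv_zero X t).symm)

theorem zero_incl : T.zero ≫ T.incl = 0 :=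
  R.hom_ext fun X t => ((T.equiv_incl _).trans (map_zero (constHom X.unop.algebra))).trans
    (R.equiv_zero X t).symm

theorem exists_scale : ∃ k : T ⊗ R ⟶ T, k ≫ T.incl = snd T R * (fst T R ≫ T.incl) :=
  exists_comp_incl _ (by
    have h : (fst T R ≫ T.incl) * (fst T R ≫ T.incl) = 0 := by
      rw [← MonObj.comp_mul, incl_mul_incl, AddMonObj.comp_zero]
    rw [_root_.mul_mul_mul_comm, h, mul_zero])

/-- The action of `R` on `T` by multiplication. -/
def scaleT : T ⊗ R ⟶ T := exists_scale.choose

theorem scaleT_incl : scaleT ≫ T.incl = snd T R * (fst T R ≫ T.incl) := exists_scale.choose_spec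

theorem lift_scaleT_incl {Z : Psh} (t : Z ⟶ T) (b : Z ⟶ R) :
    lift t b ≫ scaleT ≫ T.incl = b * (t ≫ T.incl) := by
  rw [scaleT_incl, MonObj.comp_mul, lift_snd, lift_fst_assoc]

/-- The Euler real `t ↦ b t`. -/
def toEuler : R ⟶ EulerReals T T.zero :=
  pullback.lift (MonoidalClosed.curry scaleT) (toUnit _) (by
    rw [comp_evalAt, ← Category.id_comp (MonoidalClosed.curry scaleT), applyAt_curry,
      ← cancel_mono T.incl, Category.assoc, lift_scaleT_incl, Category.assoc, zero_incl,
      AddMonObj.comp_zero, mul_zero])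

theorem toEuler_incl : toEuler ≫ EulerReals.incl T T.zero = MonoidalClosed.curry scaleT :=
  pullback.lift_fst _ _ _

instance : IsIso (MonoidalClosed.curry (affineMap T.incl)) :=
  isIso_curry_affineMap isSquareZeroIncl_T

/-- The pair `(a, b)` of coefficients of an element `t ↦ a + b t` of `R^T`. -/
def coeffs : EulerReals T T.zero ⟶ R ⊗ R :=
  EulerReals.incl T T.zero ≫ (ihom T).map T.incl ≫ inv (MonoidalClosed.curry (affineMap T.incl))

theorem lift_affineMap {Z : Psh} (t : Z ⟶ T) (a b : Z ⟶ R) :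
    lift t (lift a b) ≫ affineMap T.incl = a + b * (t ≫ T.incl) := by
  simp only [affineMap, AddMonObj.comp_add, MonObj.comp_mul, lift_fst_assoc, lift_snd_assoc, lift_fst,
    lift_snd]

theorem applyAt_incl_incl {Z : Psh} (r : Z ⟶ EulerReals T T.zero) (t : Z ⟶ T) :
    applyAt (r ≫ EulerReals.incl T T.zero) t ≫ T.incl =
      (r ≫ coeffs ≫ fst _ _) + (r ≫ coeffs ≫ snd _ _) * (t ≫ T.incl) := by
  have h : (r ≫ EulerReals.incl T T.zero) ≫ (ihom T).map T.incl =
      lift (r ≫ coeffs ≫ fst _ _) (r ≫ coeffs ≫ snd _ _) ≫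
        MonoidalClosed.curry (affineMap T.incl) := by
    have h1 : lift (r ≫ coeffs ≫ fst _ _) (r ≫ coeffs ≫ snd _ _) = r ≫ coeffs := by ext <;> simp
    rw [h1]
    simp [coeffs]
  rw [applyAt_comp, h, applyAt_curry, lift_affineMap]

/-- The linear coefficient of an Euler real. -/
def fromEuler : EulerReals T T.zero ⟶ R := coeffs ≫ snd _ _

/-- An Euler real is affine with values in `R`; since it fixes `0`, its constant coefficient
vanishes. -/
theorem applyAt_eq_mul {Z : Psh} (r : Z ⟶ EulerReals T T.zero) (t : Z ⟶ T) :
    applyAt (r ≫ EulerReals.incl T T.zero) t ≫ T.incl = (r ≫ fromEuler) * (t ≫ T.incl) := by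
  have h0 := applyAt_incl_incl r (toUnit Z ≫ T.zero)
  rw [EulerReals.incl_evalAt, Category.assoc, zero_incl, AddMonObj.comp_zero, mul_zero, add_zero] at h0
  rw [applyAt_incl_incl, ← h0, zero_add, fromEuler]

/-- A universally quantified `t` in `T` can be cancelled: `b` is the linear coefficient of `t ↦ b
t`, and `R × R → R^T` is monic. -/
theorem eq_of_mul_eq {Z : Psh} {b b' : Z ⟶ R}
    (h : ∀ {Y : Psh} (y : Y ⟶ Z) (t : Y ⟶ T),
      (y ≫ b) * (t ≫ T.incl) = (y ≫ b') * (t ≫ T.incl)) : b = b' := by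
  have h1 : lift 0 b ≫ MonoidalClosed.curry (affineMap T.incl) =
      lift 0 b' ≫ MonoidalClosed.curry (affineMap T.incl) := by
    refine ihom_ext fun y t => ?_
    rw [← Category.assoc, ← Category.assoc, applyAt_curry, applyAt_curry, comp_lift, comp_lift,
      lift_affineMap, lift_affineMap, h]
  simpa using (cancel_mono _).1 h1 =≫ snd _ _

theorem euler_ext {Z : Psh} {r r' : Z ⟶ EulerReals T T.zero}
    (h : r ≫ fromEuler = r' ≫ fromEuler) : r = r' := by
  refine EulerReals.ext_incl (ihom_ext fun y t => ?_)
  rw [← cancel_mono T.incl, ← Category.assoc, ← Category.assoc, applyAt_eq_mul, applyAt_eq_mul,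
    Category.assoc, Category.assoc, h]

theorem toEuler_fromEuler : toEuler ≫ fromEuler = 𝟙 R := by
  refine eq_of_mul_eq fun y t => ?_
  rw [← Category.assoc, ← applyAt_eq_mul, Category.assoc, toEuler_incl, applyAt_curry,
    Category.assoc, lift_scaleT_incl, Category.comp_id]

/-- The Euler reals are the multiplicative part of `R`. -/
def eulerIso : EulerReals T T.zero ≅ R where
  hom := fromEuler
  inv := toEuler
  inv_hom_id := toEuler_fromEuler
  hom_inv_id := by
    apply euler_ext
    rw [Category.assoc, toEuler_fromEuler, Category.comp_id, Category.id_comp]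

/-- Both sides are compared after multiplication by a generic `t`: composing `t ↦ b t` with `t ↦ b'
t` multiplies the slopes, and `t` cancels. -/
theorem isMonHom_fromEuler : IsMonHom fromEuler where
  one_hom := by
    refine eq_of_mul_eq fun y t => ?_
    rw [← Category.assoc, ← applyAt_eq_mul, Category.assoc]
    have h : η[EulerReals T T.zero] ≫ EulerReals.incl T T.zero = MonoidalClosed.id T :=
      EulerReals.one_incl T T.zero
    rw [h, applyAt_id]
    have h1 : y ≫ η[R] = (1 : _ ⟶ R) := congrArg (· ≫ η[R]) (toUnit_unique y (toUnit _))
    rw [h1, _root_.one_mul]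
  mul_hom := by
    refine eq_of_mul_eq fun y t => ?_
    obtain ⟨g, f, rfl⟩ : ∃ g f, y = lift g f := ⟨y ≫ fst _ _, y ≫ snd _ _, by ext <;> simp⟩
    have h1 : lift g f ≫ (fromEuler ⊗ₘ fromEuler) ≫ μ[R] =
        (g ≫ fromEuler) * (f ≫ fromEuler) := by
      rw [lift_map_assoc]; rfl
    have h2 : (lift g f ≫ μ[EulerReals T T.zero]) ≫ EulerReals.incl T T.zero =
        lift (g ≫ EulerReals.incl T T.zero) (f ≫ EulerReals.incl T T.zero) ≫ endComp T :=
      EulerReals.lift_mul_incl g f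
    rw [h1, ← Category.assoc, ← applyAt_eq_mul, h2, applyAt_endComp, applyAt_eq_mul, applyAt_eq_mul,
      _root_.mul_assoc]

end Euler


/-! ### The components of the group of units -/

section Units

open MonObj
open scoped CommRingObj RingObj

/-- The invertible Euler reals. -/
abbrev EulerUnits : Psh := Invertibles (EulerReals T T.zero)

/-- The inclusion of the invertible Euler reals in `R`. -/
def EulerUnits.toR : EulerUnits ⟶ R := Invertibles.incl (EulerReals T T.zero) ≫ fromEuler

instance : Mono EulerUnits.toR :=
  have : Mono fromEuler := inferInstanceAs (Mono eulerIso.hom)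
  mono_comp _ _

theorem EulerUnits.toR_injective (X : Siteᵒᵖ) : Function.Injective (EulerUnits.toR.app X) :=
  (mono_iff_injective _).1 inferInstance

/-- With `toR_injective` and `exists_toR_eq`, this identifies the sections of `U` over `Spec A` with
the units of `A`. -/
theorem EulerUnits.exists_mul_eq_one {X : Siteᵒᵖ} (x : EulerUnits.obj X) :
    ∃ b, R.equiv X (EulerUnits.toR.app X x) * b = 1 := by
  have := isMonHom_fromEuler
  have h := (Invertibles.mul_eq_one (EulerReals T T.zero) (𝟙 _)).1 =≫ fromEuler
  rw [MonObj.mul_comp, MonObj.one_comp] at h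
  have h' := congrArg (fun k => R.equiv X (k.app X x)) h
  exact ⟨_, (R.equiv_mul _ _ X x).symm.trans (h'.trans (R.equiv_one X x))⟩

theorem EulerUnits.exists_toR_eq {X : Siteᵒᵖ} {a b : X.unop.algebra} (h : a * b = 1) :
    ∃ x, R.equiv X (EulerUnits.toR.app X x) = a := by
  have := isMonHom_fromEuler
  let el (c : X.unop.algebra) : yoneda.obj X.unop ⟶ R := yonedaEquiv.symm ((R.equiv X).symm c)
  have hel (c d : X.unop.algebra) (hcd : c * d = 1) : el c * el d = 1 := by
    refine yonedaEquiv.injective ((R.equiv X).injective ?_)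
    refine (R.equiv_mul _ _ X _).trans
      (Eq.trans ?_ (R.equiv_one (P := yoneda.obj X.unop) X (𝟙 X.unop)).symm)
    change R.equiv X (yonedaEquiv (yonedaEquiv.symm _)) *
      R.equiv X (yonedaEquiv (yonedaEquiv.symm _)) = 1
    rw [Equiv.apply_symm_apply, Equiv.apply_symm_apply, Equiv.apply_symm_apply,
      Equiv.apply_symm_apply, hcd]
  have hel' (c d : X.unop.algebra) (hcd : c * d = 1) :
      (el c ≫ toEuler) * (el d ≫ toEuler) = 1 := by
    apply euler_ext
    rw [MonObj.mul_comp, MonObj.one_comp, Category.assoc, Category.assoc, toEuler_fromEuler,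
      Category.comp_id, Category.comp_id, hel c d hcd]
  let k : yoneda.obj X.unop ⟶ EulerUnits :=
      equalizer.lift (lift (el a ≫ toEuler) (el b ≫ toEuler)) (by
    rw [comp_lift, comp_lift, MonObj.comp_mul, MonObj.comp_mul, MonObj.comp_one, lift_fst, lift_snd,
      hel' a b h, hel' b a ((mul_comm b a).trans h)])
  have hk : k ≫ EulerUnits.toR = el a := by
    have h1 : k ≫ Invertibles.pair _ = lift (el a ≫ toEuler) (el b ≫ toEuler) := equalizer.lift_ι _ _
    rw [EulerUnits.toR, Invertibles.incl, Category.assoc, reassoc_of% h1, lift_fst_assoc,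
      Category.assoc, toEuler_fromEuler, Category.comp_id]
  refine ⟨yonedaEquiv k, ((R.equiv X).symm_apply_eq.1 ?_).symm⟩
  rw [← yonedaEquiv_comp, hk, Equiv.apply_symm_apply]

end Units

/-! ### Signs of units, and the two components -/

section Signs

/-- The positive invertible elements. -/
def EulerUnits.IsPos {X : Siteᵒᵖ} (x : EulerUnits.obj X) : Prop :=
  ∃ a, R.equiv X (EulerUnits.toR.app X x) = cexp a

theorem EulerUnits.eq_neg_of_not_isPos {X : Siteᵒᵖ} {x : EulerUnits.obj X}
    (h : ¬ EulerUnits.IsPos x) : ∃ a, R.equiv X (EulerUnits.toR.app X x) = -cexp a := by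
  obtain ⟨b, hb⟩ := EulerUnits.exists_mul_eq_one x
  obtain ⟨a, ha | ha⟩ := exists_eq_cexp X.unop.unop.property.2.1.2 hb
  · exact absurd ⟨a, ha⟩ h
  · exact ⟨a, ha⟩

/-- A copoint sends both sides to `ℝ`, where exponentials are positive. -/
theorem cexp_ne_neg_cexp {X : Siteᵒᵖ} (a b : X.unop.algebra) : cexp a ≠ -cexp b := by
  obtain ⟨φ⟩ := X.unop.unop.property.2.2.1
  intro h
  have h1 := congrArg φ h
  rw [map_neg, map_cexp, map_cexp, cexp_real, cexp_real] at h1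
  linarith [Real.exp_pos (φ a), Real.exp_pos (φ b)]

/-- Morphisms preserve both forms `exp a` and `-exp a`, which exclude each other. -/
theorem EulerUnits.isPos_map {X Y : Siteᵒᵖ} (f : X ⟶ Y) (x : EulerUnits.obj X) :
    EulerUnits.IsPos (EulerUnits.map f x) ↔ EulerUnits.IsPos x := by
  constructor
  · rintro ⟨b, hb⟩
    by_contra hx
    obtain ⟨a, ha⟩ := EulerUnits.eq_neg_of_not_isPos hx
    rw [R.equiv_naturality, ha, map_neg, map_cexp] at hb
    exact cexp_ne_neg_cexp _ _ hb.symm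
  · rintro ⟨a, ha⟩
    exact ⟨f.unop.unop.hom.hom a, by rw [R.equiv_naturality, ha, map_cexp]⟩

open Classical in
/-- The sign of an invertible element. -/
def EulerUnits.signCocone : Cocone EulerUnits where
  pt := Bool
  ι :=
    { app := fun X => TypeCat.ofHom fun x => decide (EulerUnits.IsPos (X := X) x)
      naturality := fun X Y f => by
        ext x
        exact decide_eq_decide.2 (EulerUnits.isPos_map f x) }

/-- Elements of a presheaf which are restrictions of the same element belong to the same
component. -/
theorem components_eq {P : Psh} {X Y : Siteᵒᵖ} (f : X ⟶ Y) (x : P.obj X) :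
    colimit.ι P Y (P.map f x) = colimit.ι P X x :=
  ConcreteCategory.congr_hom (C := Type) (colimit.w P f) x

/-- The object `C^∞(ℝ)` of the indexing category of presheaves. -/
def lineObj : Siteᵒᵖ := Opposite.op (Site.spec ⟨smoothLine⟩ CInftyRingCat.isSiteAlgebra_smoothLine)

/-- The morphism from `C^∞(ℝ)` determined by an element. -/
def lineHom {X : Siteᵒᵖ} (a : X.unop.algebra) : lineObj ⟶ X :=
  Site.ofHom ((smoothLine.homEquiv X.unop.algebra).symm a)

theorem lineHom_X {X : Siteᵒᵖ} (a : X.unop.algebra) :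
    (lineHom a).unop.unop.hom.hom smoothLine.X = a :=
  (smoothLine.homEquiv X.unop.algebra).apply_symm_apply a

open Classical in
/-- All invertible elements of the same sign are in the component of the same element of
`C^∞(ℝ)`. -/
theorem EulerUnits.exists_components_eq (s : Bool) : ∃ w : EulerUnits.obj lineObj,
    EulerUnits.signCocone.ι.app lineObj w = s ∧
    ∀ (X : Siteᵒᵖ) (x : EulerUnits.obj X), EulerUnits.signCocone.ι.app X x = s →
      colimit.ι EulerUnits X x = colimit.ι EulerUnits lineObj w := by
  -- `± exp t` are the generic units: `lineHom a` sends `t` to `a`, hence restricts them to `± exp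
  -- a`.
  let t : lineObj.unop.algebra := smoothLine.X
  cases s
  · obtain ⟨w, hw⟩ := EulerUnits.exists_toR_eq (X := lineObj) (a := -cexp t) (b := -cexp (-t))
      (by rw [neg_mul_neg, cexp_mul_cexp_neg])
    refine ⟨w, decide_eq_false ?_, fun X x hx => ?_⟩
    · rintro ⟨a, ha⟩
      exact cexp_ne_neg_cexp _ _ (ha.symm.trans hw)
    · obtain ⟨a, ha⟩ := EulerUnits.eq_neg_of_not_isPos (of_decide_eq_false hx)
      have : EulerUnits.map (lineHom a) w = x := by
        apply EulerUnits.toR_injective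
        apply (R.equiv X).injective
        rw [R.equiv_naturality, hw, ha, map_neg, map_cexp]
        exact congrArg (fun b => -cexp b) (lineHom_X a)
      rw [← this]
      exact components_eq _ _
  · obtain ⟨w, hw⟩ := EulerUnits.exists_toR_eq (X := lineObj) (cexp_mul_cexp_neg t)
    refine ⟨w, decide_eq_true ⟨_, hw⟩, fun X x hx => ?_⟩
    obtain ⟨a, ha⟩ := of_decide_eq_true hx
    have : EulerUnits.map (lineHom a) w = x := by
      apply EulerUnits.toR_injective
      apply (R.equiv X).injective
      rw [R.equiv_naturality, hw, ha, map_cexp]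
      exact congrArg cexp (lineHom_X a)
    rw [← this]
    exact components_eq _ _

theorem isBidirectional_euler : IsBidirectional (EulerReals T T.zero) components := by
  let σ : components.obj EulerUnits ⟶ Bool := colimit.desc EulerUnits EulerUnits.signCocone
  have hσ (X : Siteᵒᵖ) (x : EulerUnits.obj X) :
      σ (colimit.ι EulerUnits X x) = EulerUnits.signCocone.ι.app X x :=
    ConcreteCategory.congr_hom (C := Type) (colimit.ι_desc EulerUnits.signCocone X) x
  have hbij : Function.Bijective σ := by
    constructor
    · intro p q hpq
      obtain ⟨X, x, rfl⟩ := Types.jointly_surjective' p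
      obtain ⟨Y, y, rfl⟩ := Types.jointly_surjective' q
      obtain ⟨w, -, h⟩ := EulerUnits.exists_components_eq (σ (colimit.ι EulerUnits X x))
      -- Two elements of equal sign lie in the component of the same generic unit.
      exact (h X x (hσ X x).symm).trans (h Y y ((hσ Y y).symm.trans hpq.symm)).symm
    · intro s
      obtain ⟨w, hw, -⟩ := EulerUnits.exists_components_eq s
      exact ⟨colimit.ι EulerUnits lineObj w, (hσ _ _).trans hw⟩
  have e : Bool ≃ (PUnit.{1} ⊕ PUnit.{1} : Type) := Equiv.boolEquivPUnitSumPUnit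
  exact ⟨(Equiv.ofBijective σ hbij).toIso ≪≫ e.toIso ≪≫ (Types.binaryCoproductIso _ _).symm ≪≫
    coprod.mapIso Types.terminalIso.symm Types.terminalIso.symm⟩

end Signs

end RSDG

end

theorem mainTheorem3 :
    RSDG.IsPreCohesive RSDG.pointsAdj ∧
    RSDG.points.IsLeftAdjoint ∧
    PreservesFiniteProducts RSDG.components ∧
    RSDG.IsBidirectional (RSDG.EulerReals RSDG.T RSDG.T.zero) RSDG.components ∧
    (∃ φ : RSDG.EulerReals RSDG.T RSDG.T.zero ≅ RSDG.R, IsMonHom φ.hom ∧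
      ∀ {Z : RSDG.Psh} (r : Z ⟶ RSDG.EulerReals RSDG.T RSDG.T.zero) (t : Z ⟶ RSDG.T),
        RSDG.applyAt (r ≫ RSDG.EulerReals.incl RSDG.T RSDG.T.zero) t ≫ RSDG.T.incl =
          lift (r ≫ φ.hom) (t ≫ RSDG.T.incl) ≫ MonObj.mul) ∧
    RSDG.IsConnectedObj RSDG.components RSDG.R ∧
    RSDG.KockLawvere RSDG.R := by
  exact ⟨RSDG.isPreCohesive_pointsAdj, RSDG.isLeftAdjoint_points, inferInstance,
    RSDG.isBidirectional_euler, ⟨RSDG.eulerIso, RSDG.isMonHom_fromEuler, RSDG.applyAt_eq_mul⟩,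
    RSDG.isConnectedObj_yoneda _, RSDG.kockLawvere_R⟩
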